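/- **Theorem (security of Arazi–Qi self-certified keys in the random oracle model).** For every security parameter $\kappa$ let $\mathbb G_\kappa$ be a group of prime order $N=N_\kappa$, written additively, with generator $\mathbf G$, and let $H:\{0,1\}^*\times\mathbb G_\kappa\to\mathbb Z_N$ be a random oracle. Consider the following experiment with an adversary $\mathcal A$. A private key $d$ is drawn uniformly from $\mathbb Z_N^*$, and $\mathcal A$ receives the public key $\mathbf D=d\times\mathbf G$. It may query, adaptively, - the random oracle $H$; - $\mathtt{KeyQry}(ID)$, which draws $b$ uniformly from $\mathbb Z_N^*$ and returns $(\mathbf U,x)$ with $\mathbf U=b\times\mathbf G$ and $x=H(ID,\mathbf U)\cdot b+d$; - $\mathtt{KeyVer}(ID,\mathbf U,x)$, which returns whether $x\times\mathbf G=H(ID,\mathbf U)\times\mathbf U+\mathbf D$. Finally $\mathcal A$ outputs $(T,\mathbf U_T,x_T)$, and it wins if $\mathtt{KeyVer}(T,\mathbf U_T,x_T)$ accepts and $T$ was never queried to $\mathtt{KeyQry}$. There is an algorithm $\mathcal C$, which runs the adversary as a (rewindable, black-box) subroutine, with the following property. Let $\mathcal A$ be any probabilistic adversary that runs in time polynomial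 in $\kappa$, makes at most $q_k(\kappa)$ queries to $\mathtt{KeyQry}$ and at most $q_h(\kappa)$ queries to $H$, and wins the experiment with non-negligible probability. Then $\mathcal C$ with the subroutine $\mathcal A$ runs in time polynomial in $\kappa$ and solves the computational Diffie–Hellman problem in $(\mathbb G_\kappa)_\kappa$ with non-negligible probability: given $a\times\mathbf G$ and $b\times\mathbf G$ for independent uniform $a,b\in\mathbb Z_N$, it outputs $ab\times\mathbf G$. Here the time of $\mathcal C$ counts its own instructions, with group operations (scalar multiplications included), arithmetic modulo $N$ and uniform sampling at unit cost, together with all steps of the copies of $\mathcal A$ that it runs. -/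

import Mathlib

open Polynomial

namespace SelfCert

/-- A cyclic group of prime order, written additively, with a fixed generator. -/
structure PrimeGroup where
  /-- the order of the group -/
  N : ℕ
  prime : N.Prime
  /-- the elements of the group -/
  Point : Type
  [group : AddCommGroup Point]
  card_eq : Nat.card Point = N
  /-- the base point -/
  gen : Point
  gen_generates : ∀ P : Point, P ∈ AddSubgroup.zmultiples gen

attribute [instance] PrimeGroup.group

instance PrimeGroup.factPrime (𝔾 : PrimeGroup) : Fact 𝔾.N.Prime := ⟨𝔾.prime⟩

/-- The scalars `ℤ_N`. -/
abbrev PrimeGroup.Scalar (𝔾 : PrimeGroup) : Type := ZMod 𝔾.N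

/-- User identities are arbitrary bit strings. -/
abbrev Ident : Type := List Bool

/-- Scalar multiplication `x × P` for `x ∈ ℤ_N`. -/
def PrimeGroup.mul (𝔾 : PrimeGroup) (x : 𝔾.Scalar) (P : 𝔾.Point) : 𝔾.Point := x.val • P

noncomputable section

/-! ## The random oracle -/

/-- The table of the lazily sampled random oracle `H`, on inputs `(ID, U)`. -/
abbrev Table (𝔾 : PrimeGroup) : Type := Ident × 𝔾.Point → Option 𝔾.Scalar

/-- Probabilistic computations with access to the random oracle. -/
abbrev ROM (𝔾 : PrimeGroup) : Type → Type := StateT (Table 𝔾) PMF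

open Classical in
/-- A query to the random oracle `H`, whose values are uniform in `ℤ_N`. -/
def hashQuery {𝔾 : PrimeGroup} (id : Ident) (U : 𝔾.Point) : ROM 𝔾 𝔾.Scalar := StateT.mk fun tbl =>
  match tbl (id, U) with
  | some h => pure (h, tbl)
  | none => do
      let h ← PMF.uniformOfFintype 𝔾.Scalar
      pure (h, Function.update tbl (id, U) (some h))

/-- A uniform sample from a nonempty finite type. -/
def uniform {𝔾 : PrimeGroup} (α : Type) [Fintype α] [Nonempty α] : ROM 𝔾 α :=
  StateT.lift (PMF.uniformOfFintype α)

/-! ## The Arazi–Qi self-certified keys -/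

/-- The system-wide private key: `d` uniform in `ℤ_N^*`; the public key is `D = d × G`. -/
def AQ.setup (𝔾 : PrimeGroup) : ROM 𝔾 𝔾.Scalar := do
  let d ← uniform (𝔾.Scalar)ˣ
  pure (d : 𝔾.Scalar)

/-- Key generation for the user `id`: `b` uniform in `ℤ_N^*`, `U = b × G`,
`x = H(id, U) · b + d`. The result is `(U, x)`. -/
def AQ.kg (𝔾 : PrimeGroup) (d : 𝔾.Scalar) (id : Ident) : ROM 𝔾 (𝔾.Point × 𝔾.Scalar) := do
  let b ← uniform (𝔾.Scalar)ˣ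
  let U := 𝔾.mul (b : 𝔾.Scalar) 𝔾.gen
  let h ← hashQuery id U
  pure (U, h * (b : 𝔾.Scalar) + d)

open Classical in
/-- Verification of a key pair `(U, x)` of the user `id`: `x × G = H(id, U) × U + D`. -/
def AQ.keyVer (𝔾 : PrimeGroup) (D : 𝔾.Point) (id : Ident) (U : 𝔾.Point) (x : 𝔾.Scalar) :
    ROM 𝔾 Bool := do
  let h ← hashQuery id U
  pure (decide (𝔾.mul x 𝔾.gen = 𝔾.mul h U + D))

/-! ## Adversaries -/

/-- What an adversary can do in one transition. -/
inductive Request (𝔾 : PrimeGroup) : Type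
  /-- an internal step -/
  | work
  /-- toss a fair coin -/
  | coin
  /-- draw a uniform scalar -/
  | scalar
  /-- query the random oracle -/
  | hash (id : Ident) (U : 𝔾.Point)
  /-- query the key oracle -/
  | keyQry (id : Ident)
  /-- query the verification oracle -/
  | keyVer (id : Ident) (U : 𝔾.Point) (x : 𝔾.Scalar)
  /-- stop, with a key pair for a target user -/
  | output (id : Ident) (U : 𝔾.Point) (x : 𝔾.Scalar)

/-- The answers to the requests of an adversary. -/
inductive Answer (𝔾 : PrimeGroup) : Type
  | done
  | bit (b : Bool)
  | scalar (h : 𝔾.Scalar)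
  | key (U : 𝔾.Point) (x : 𝔾.Scalar)

/-- The time of a transition: one unit, and one for each bit of an identity that is written. -/
def Request.time {𝔾 : PrimeGroup} : Request 𝔾 → ℕ
  | .work => 1
  | .coin => 1
  | .scalar => 1
  | .hash id _ => 1 + id.length
  | .keyQry id => 1 + id.length
  | .keyVer id _ _ => 1 + id.length
  | .output id _ _ => 1 + id.length

/-- An interactive machine. It starts on the system-wide public key; in each transition it issues
the request `ask s` and moves on to `tell s r`, where `r` is the answer. All its randomness is
obtained through requests. Every machine model with a notion of step is of this form, and the
running time of the machine is the total time of its transitions. -/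
structure Adversary (𝔾 : PrimeGroup) where
  State : Type
  init : 𝔾.Point → State
  ask : State → Request 𝔾
  tell : State → Answer 𝔾 → State

/-- From the given state, and whatever the coins and the answers of the oracles are, the machine
stops within time `t`, after at most `qk` key queries and at most `qh` hash queries. -/
inductive Adversary.HaltsWithin {𝔾 : PrimeGroup} (A : Adversary 𝔾) :
    (t qk qh : ℕ) → A.State → Prop
  | work {t qk qh : ℕ} {s : A.State} (hs : A.ask s = .work)
      (next : A.HaltsWithin t qk qh (A.tell s .done)) :
      A.HaltsWithin (t + (A.ask s).time) qk qh s
  | coin {t qk qh : ℕ} {s : A.State} (hs : A.ask s = .coin)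
      (next : ∀ b, A.HaltsWithin t qk qh (A.tell s (.bit b))) :
      A.HaltsWithin (t + (A.ask s).time) qk qh s
  | scalar {t qk qh : ℕ} {s : A.State} (hs : A.ask s = .scalar)
      (next : ∀ h, A.HaltsWithin t qk qh (A.tell s (.scalar h))) :
      A.HaltsWithin (t + (A.ask s).time) qk qh s
  | hash {t qk qh : ℕ} {s : A.State} (id : Ident) (U : 𝔾.Point) (hs : A.ask s = .hash id U)
      (next : ∀ h, A.HaltsWithin t qk qh (A.tell s (.scalar h))) :
      A.HaltsWithin (t + (A.ask s).time) qk (qh + 1) s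
  | keyQry {t qk qh : ℕ} {s : A.State} (id : Ident) (hs : A.ask s = .keyQry id)
      (next : ∀ U x, A.HaltsWithin t qk qh (A.tell s (.key U x))) :
      A.HaltsWithin (t + (A.ask s).time) (qk + 1) qh s
  | keyVer {t qk qh : ℕ} {s : A.State} (id : Ident) (U : 𝔾.Point) (x : 𝔾.Scalar)
      (hs : A.ask s = .keyVer id U x)
      (next : ∀ b, A.HaltsWithin t qk qh (A.tell s (.bit b))) :
      A.HaltsWithin (t + (A.ask s).time) qk qh s
  | output {t qk qh : ℕ} {s : A.State} (id : Ident) (U : 𝔾.Point) (x : 𝔾.Scalar)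
      (hs : A.ask s = .output id U x) :
      A.HaltsWithin (t + (A.ask s).time) qk qh s

/-! ## The key-generation security experiment -/

open Classical in
/-- The interaction of the adversary, in state `s`, with the oracles, for `n` transitions. The list
`L` holds the users that were queried to the key oracle so far. The result is whether the adversary
has stopped with a valid key pair for a user that was never queried. -/
def Adversary.play {𝔾 : PrimeGroup} (A : Adversary 𝔾) (d : 𝔾.Scalar) :
    (n : ℕ) → (L : List Ident) → (s : A.State) → ROM 𝔾 Bool
  | 0, _, _ => pure false
  | n + 1, L, s =>
    match A.ask s with
    | .work => A.play d n L (A.tell s .done)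
    | .coin => do
        let b ← uniform Bool
        A.play d n L (A.tell s (.bit b))
    | .scalar => do
        let r ← uniform 𝔾.Scalar
        A.play d n L (A.tell s (.scalar r))
    | .hash id U => do
        let h ← hashQuery id U
        A.play d n L (A.tell s (.scalar h))
    | .keyQry id => do
        let k ← AQ.kg 𝔾 d id
        A.play d n (id :: L) (A.tell s (.key k.1 k.2))
    | .keyVer id U x => do
        let v ← AQ.keyVer 𝔾 (𝔾.mul d 𝔾.gen) id U x
        A.play d n L (A.tell s (.bit v))
    | .output id U x => do
        let v ← AQ.keyVer 𝔾 (𝔾.mul d 𝔾.gen) id U x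
        pure (v && decide (id ∉ L))

/-- The experiment, cut off after `n` transitions of the adversary. -/
def Adversary.experiment {𝔾 : PrimeGroup} (A : Adversary 𝔾) (n : ℕ) : ROM 𝔾 Bool := do
  let d ← AQ.setup 𝔾
  A.play d n [] (A.init (𝔾.mul d 𝔾.gen))

/-- The probability that the adversary wins the experiment; the random oracle starts empty. -/
def Adversary.advantage {𝔾 : PrimeGroup} (A : Adversary 𝔾) : ENNReal :=
  ⨆ n : ℕ, (Prod.fst <$> (A.experiment n).run (fun _ => none)) true

/-! ## Algorithms that run an adversary as a subroutine

A program is a closed term of a small typed first-order language. It works with the group through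
the group operations only. It can start copies of the adversary, see the pending request of a copy,
answer it in any way, and keep, copy and resume states of the adversary, which are opaque to it.
Every instruction costs one unit of time, and those that handle identities also the length of
these; so each transition of a copy of the adversary is charged to the program as well. -/

/-- The types of the values in a program. -/
inductive Ty : Type
  | unit | bool | ident | scalar | point
  /-- states of the adversary -/
  | state
  | prod (α β : Ty)
  | sum (α β : Ty)
  | list (α : Ty)

/-- The values of a type. -/
@[reducible]
def Ty.Val {𝔾 : PrimeGroup} (A : Adversary 𝔾) : Ty → Type
  | .unit => Unit
  | .bool => Bool
  | .ident => Ident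
  | .scalar => 𝔾.Scalar
  | .point => 𝔾.Point
  | .state => A.State
  | .prod α β => α.Val A × β.Val A
  | .sum α β => α.Val A ⊕ β.Val A
  | .list α => List (α.Val A)

/-- Requests of the adversary, as seen by a program. -/
abbrev Ty.request : Ty :=
  .sum .unit <| .sum .unit <| .sum .unit <| .sum (.prod .ident .point) <| .sum .ident <|
    .sum (.prod .ident (.prod .point .scalar)) (.prod .ident (.prod .point .scalar))

/-- The request as a value: internal step, coin, scalar, hash query, key query, verification query,
output, in this order. -/
def Request.toVal {𝔾 : PrimeGroup} (A : Adversary 𝔾) : Request 𝔾 → Ty.request.Val A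
  | .work => .inl ()
  | .coin => .inr (.inl ())
  | .scalar => .inr (.inr (.inl ()))
  | .hash id U => .inr (.inr (.inr (.inl (id, U))))
  | .keyQry id => .inr (.inr (.inr (.inr (.inl id))))
  | .keyVer id U x => .inr (.inr (.inr (.inr (.inr (.inl (id, U, x))))))
  | .output id U x => .inr (.inr (.inr (.inr (.inr (.inr (id, U, x))))))

/-- Programs with an input of type `α` and an output of type `β`. -/
inductive Prog : Ty → Ty → Type
  /- composition, pairs, sums, branching, lists -/
  | skip {α : Ty} : Prog α α
  | seq {α β γ : Ty} (f : Prog α β) (g : Prog β γ) : Prog α γ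
  | pair {α β γ : Ty} (f : Prog α β) (g : Prog α γ) : Prog α (.prod β γ)
  | fst {α β : Ty} : Prog (.prod α β) α
  | snd {α β : Ty} : Prog (.prod α β) β
  | unit {α : Ty} : Prog α .unit
  | inl {α β : Ty} : Prog α (.sum α β)
  | inr {α β : Ty} : Prog β (.sum α β)
  | case {α β γ δ : Ty} (f : Prog (.prod γ α) δ) (g : Prog (.prod γ β) δ) :
      Prog (.prod γ (.sum α β)) δ
  | ite {γ δ : Ty} (f g : Prog γ δ) : Prog (.prod γ .bool) δ
  | nil {α β : Ty} : Prog α (.list β)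
  | cons {α : Ty} : Prog (.prod α (.list α)) (.list α)
  | uncons {α : Ty} : Prog (.list α) (.sum .unit (.prod α (.list α)))
  /- repeat the body as long as it answers in the left summand -/
  | loop {α β : Ty} (body : Prog α (.sum α β)) : Prog α β
  /- equality tests -/
  | eqIdent : Prog (.prod .ident .ident) .bool
  | eqScalar : Prog (.prod .scalar .scalar) .bool
  | eqPoint : Prog (.prod .point .point) .bool
  /- arithmetic modulo `N` -/
  | one {α : Ty} : Prog α .scalar
  | add : Prog (.prod .scalar .scalar) .scalar
  | neg : Prog .scalar .scalar
  | mul : Prog (.prod .scalar .scalar) .scalar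
  | inv : Prog .scalar .scalar
  /- the group -/
  | gen {α : Ty} : Prog α .point
  | addPoint : Prog (.prod .point .point) .point
  | negPoint : Prog .point .point
  | mulPoint : Prog (.prod .scalar .point) .point
  /- randomness -/
  | coin {α : Ty} : Prog α .bool
  | sample {α : Ty} : Prog α .scalar
  /- the adversary -/
  | start : Prog .point .state
  | ask : Prog .state Ty.request
  | tellDone : Prog .state .state
  | tellBit : Prog (.prod .state .bool) .state
  | tellScalar : Prog (.prod .state .scalar) .state
  | tellKey : Prog (.prod .state (.prod .point .scalar)) .state

/-- Probabilistic computations with a time budget: the state is the time that is left, and the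
computation is abandoned when the budget is exceeded. -/
abbrev Timed : Type → Type := StateT ℕ (OptionT PMF)

/-- Spend time `k`. -/
def spend (k : ℕ) : Timed Unit :=
  StateT.mk fun t => if k ≤ t then pure ((), t - k) else failure

/-- A uniform sample, within a timed computation. -/
def Timed.uniform (α : Type) [Fintype α] [Nonempty α] : Timed α :=
  StateT.lift (OptionT.lift (PMF.uniformOfFintype α))

/-- At most `n` rounds of a loop, each of which costs at least one unit of time. -/
def Timed.loop {α β : Type} (body : α → Timed (α ⊕ β)) : (n : ℕ) → α → Timed β
  | 0, _ => failure
  | n + 1, a => do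
      spend 1
      match ← body a with
      | .inl a' => Timed.loop body n a'
      | .inr b => pure b

open Classical in
/-- The execution of a program that runs the adversary `A` as a subroutine. -/
def Prog.eval {𝔾 : PrimeGroup} (A : Adversary 𝔾) :
    {α β : Ty} → Prog α β → α.Val A → Timed (β.Val A)
  | _, _, .skip, a => do spend 1; pure a
  | _, _, .seq f g, a => do spend 1; let b ← f.eval A a; g.eval A b
  | _, _, .pair f g, a => do spend 1; let b ← f.eval A a; let c ← g.eval A a; pure (b, c)
  | _, _, .fst, a => do spend 1; pure a.1
  | _, _, .snd, a => do spend 1; pure a.2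
  | _, _, .unit, _ => do spend 1; pure ()
  | _, _, .inl, a => do spend 1; pure (Sum.inl a)
  | _, _, .inr, a => do spend 1; pure (Sum.inr a)
  | _, _, .case f g, (c, s) => do
      spend 1
      match s with
      | .inl a => f.eval A (c, a)
      | .inr b => g.eval A (c, b)
  | _, _, .ite f g, (c, b) => do
      spend 1
      match b with
      | true => f.eval A c
      | false => g.eval A c
  | _, _, .nil, _ => do spend 1; pure []
  | _, _, .cons, (a, l) => do spend 1; pure (a :: l)
  | _, _, .uncons, l => do
      spend 1
      match l with
      | [] => pure (Sum.inl ())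
      | a :: l' => pure (Sum.inr (a, l'))
  /- every round costs at least one unit, so that the bound on the rounds is never reached -/
  | _, _, .loop body, a => StateT.mk fun t =>
      (Timed.loop (fun a => body.eval A a) (t + 1) a).run t
  | _, _, .eqIdent, (a, b) => do spend (1 + a.length + b.length); pure (decide (a = b))
  | _, _, .eqScalar, (a, b) => do spend 1; pure (decide (a = b))
  | _, _, .eqPoint, (a, b) => do spend 1; pure (decide (a = b))
  | _, _, .one, _ => do spend 1; pure (1 : 𝔾.Scalar)
  | _, _, .add, (a, b) => do spend 1; pure (HAdd.hAdd (α := 𝔾.Scalar) a b)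
  | _, _, .neg, a => do spend 1; pure (Neg.neg (α := 𝔾.Scalar) a)
  | _, _, .mul, (a, b) => do spend 1; pure (HMul.hMul (α := 𝔾.Scalar) a b)
  | _, _, .inv, a => do spend 1; pure (Inv.inv (α := 𝔾.Scalar) a)
  | _, _, .gen, _ => do spend 1; pure 𝔾.gen
  | _, _, .addPoint, (P, Q) => do spend 1; pure (HAdd.hAdd (α := 𝔾.Point) P Q)
  | _, _, .negPoint, P => do spend 1; pure (Neg.neg (α := 𝔾.Point) P)
  | _, _, .mulPoint, (a, P) => do spend 1; pure (𝔾.mul a P)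
  | _, _, .coin, _ => do spend 1; Timed.uniform Bool
  | _, _, .sample, _ => do spend 1; Timed.uniform 𝔾.Scalar
  | _, _, .start, P => do spend 1; pure (A.init P)
  | _, _, .ask, s => do spend (A.ask s).time; pure ((A.ask s).toVal A)
  | _, _, .tellDone, s => do spend 1; pure (A.tell s .done)
  | _, _, .tellBit, (s, b) => do spend 1; pure (A.tell s (.bit b))
  | _, _, .tellScalar, (s, h) => do spend 1; pure (A.tell s (.scalar h))
  | _, _, .tellKey, (s, k) => do spend 1; pure (A.tell s (.key k.1 k.2))

/-- The result of the program within time `t`; it is `none` if the program takes longer. -/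
def Prog.runWithin {𝔾 : PrimeGroup} (A : Adversary 𝔾) {α β : Ty} (C : Prog α β) (t : ℕ)
    (a : α.Val A) : PMF (Option (β.Val A)) :=
  Option.map Prod.fst <$> ((C.eval A a).run t).run

/-- On the input `a` the program stops within time `t`, whatever its coins are. -/
def Prog.HaltsWithin {𝔾 : PrimeGroup} (A : Adversary 𝔾) {α β : Ty} (C : Prog α β) (t : ℕ)
    (a : α.Val A) : Prop :=
  none ∉ (C.runWithin A t a).support

/-! ## The Diffie–Hellman problem -/

open Classical in
/-- The probability that the program, given `a × G` and `b × G` for uniform `a, b ∈ ℤ_N`, outputs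
`(a · b) × G` within time `t`. -/
def dhSuccess {𝔾 : PrimeGroup} (A : Adversary 𝔾) (C : Prog (.prod .point .point) .point)
    (t : ℕ) : ENNReal :=
  (show PMF Bool from do
    let a ← PMF.uniformOfFintype 𝔾.Scalar
    let b ← PMF.uniformOfFintype 𝔾.Scalar
    let r ← C.runWithin A t (𝔾.mul a 𝔾.gen, 𝔾.mul b 𝔾.gen)
    pure (decide (r = some (𝔾.mul (a * b) 𝔾.gen)))) true

/-! ## Asymptotics -/

/-- A function of the security parameter is negligible if it decays faster than the inverse of
every polynomial. -/
def Negligible (f : ℕ → ENNReal) : Prop :=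
  Asymptotics.SuperpolynomialDecay Filter.atTop (fun κ : ℕ => (κ : ℝ)) (fun κ => (f κ).toReal)

end

end SelfCert

open SelfCert

/-! The reduction is a forking argument. It takes the first Diffie–Hellman point as public key `D =
d × G`, so `d` is unknown, and samples hash values lazily. For a key query it draws `r` and `x`
uniformly, puts `U = r⁻¹ × (x × G - D)` and programs `H(ID, U) = r`. For `r ≠ 0` the map `b ↦ r * b
+ d` is a bijection, so this has the law of the real answer unless `(ID, U)` already has a hash
value. With the cases `r = 0` and `b = 0` the loss is at most `(length + 2) / N` per key query,
where `length` is the size of the table (`prob_keyQry_le`); `prob_play_le` adds up these losses.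

A valid key pair with `U = u × G` and hash value `h` satisfies `x = h * u + d`. A second one with
the same `U` and another hash value gives a second linear equation, and the two determine `d`
(`dlog_eq`). To obtain it, each table entry records the state that caused it, and the table at that
time is the tail of the list; the run is repeated from the entry of the forgery. In a winning run
that entry does not come from a key query, because the target was never queried. If `W` is the
probability of a win in the simulation, `V` that of a successful fork and `B` bounds the number of
transitions, then `W² ≤ B * (V + B / N)`. This is `sq_simExpect_winInd_le`, proved by induction on
the transitions with the Cauchy–Schwarz inequality, without guessing the critical query.

Nothing is assumed about the growth of `N`, so errors of order `1 / N` need not be negligible. The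
reduction therefore guesses the solution with probability one half. Its success is at least `(1 / N
+ V) / 2`, which pays for these errors as well: the square of the advantage is at most a polynomial
times the success (`sq_advantage_le`).

The running time is treated separately. `Prog.sem` has no clock and fails only if a loop or an
instruction exceeds a bound `F`. Where it cannot fail, the timed execution agrees with it within
`Prog.cost F`, a polynomial in `F` (`Prog.simulates`); `F = 2 * B + 1` suffices. -/

namespace SelfCert

noncomputable section

open scoped BigOperators

/-! ## Evaluation of programs without a clock -/

/-- At most `n` rounds of a loop, without a clock. -/
def rounds {α β : Type} (body : α → OptionT PMF (α ⊕ β)) : ℕ → α → OptionT PMF β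
  | 0, _ => failure
  | n + 1, a => body a >>= fun r => match r with
      | .inl a' => rounds body n a'
      | .inr b => pure b

open Classical in
/-- The execution of a program without a clock. It fails when a loop takes more than `F` rounds or
a single instruction takes more than `F` units of time. -/
def Prog.sem {𝔾 : PrimeGroup} (A : Adversary 𝔾) (F : ℕ) :
    {α β : Ty} → Prog α β → α.Val A → OptionT PMF (β.Val A)
  | _, _, .skip, a => pure a
  | _, _, .seq f g, a => f.sem A F a >>= fun b => g.sem A F b
  | _, _, .pair f g, a => f.sem A F a >>= fun b => g.sem A F a >>= fun c => pure (b, c)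
  | _, _, .fst, a => pure a.1
  | _, _, .snd, a => pure a.2
  | _, _, .unit, _ => pure ()
  | _, _, .inl, a => pure (Sum.inl a)
  | _, _, .inr, a => pure (Sum.inr a)
  | _, _, .case f g, (c, s) =>
      match s with
      | .inl a => f.sem A F (c, a)
      | .inr b => g.sem A F (c, b)
  | _, _, .ite f g, (c, b) =>
      match b with
      | true => f.sem A F c
      | false => g.sem A F c
  | _, _, .nil, _ => pure []
  | _, _, .cons, (a, l) => pure (a :: l)
  | _, _, .uncons, l =>
      match l with
      | [] => pure (Sum.inl ())
      | a :: l' => pure (Sum.inr (a, l'))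
  | _, _, .loop body, a => rounds (fun a => body.sem A F a) F a
  | _, _, .eqIdent, (a, b) =>
      if 1 + a.length + b.length ≤ F then pure (decide (a = b)) else failure
  | _, _, .eqScalar, (a, b) => pure (decide (a = b))
  | _, _, .eqPoint, (a, b) => pure (decide (a = b))
  | _, _, .one, _ => pure (1 : 𝔾.Scalar)
  | _, _, .add, (a, b) => pure (HAdd.hAdd (α := 𝔾.Scalar) a b)
  | _, _, .neg, a => pure (Neg.neg (α := 𝔾.Scalar) a)
  | _, _, .mul, (a, b) => pure (HMul.hMul (α := 𝔾.Scalar) a b)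
  | _, _, .inv, a => pure (Inv.inv (α := 𝔾.Scalar) a)
  | _, _, .gen, _ => pure 𝔾.gen
  | _, _, .addPoint, (P, Q) => pure (HAdd.hAdd (α := 𝔾.Point) P Q)
  | _, _, .negPoint, P => pure (Neg.neg (α := 𝔾.Point) P)
  | _, _, .mulPoint, (a, P) => pure (𝔾.mul a P)
  | _, _, .coin, _ => OptionT.lift (PMF.uniformOfFintype Bool)
  | _, _, .sample, _ => OptionT.lift (PMF.uniformOfFintype 𝔾.Scalar)
  | _, _, .start, P => pure (A.init P)
  | _, _, .ask, s => if (A.ask s).time ≤ F then pure ((A.ask s).toVal A) else failure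
  | _, _, .tellDone, s => pure (A.tell s .done)
  | _, _, .tellBit, (s, b) => pure (A.tell s (.bit b))
  | _, _, .tellScalar, (s, h) => pure (A.tell s (.scalar h))
  | _, _, .tellKey, (s, k) => pure (A.tell s (.key k.1 k.2))

/-- The time that suffices for a program whose evaluation with the bound `F` does not fail. -/
def Prog.cost (F : ℕ) : {α β : Ty} → Prog α β → ℕ
  | _, _, .seq f g => 1 + (f.cost F + g.cost F)
  | _, _, .pair f g => 1 + (f.cost F + g.cost F)
  | _, _, .case f g => 1 + (f.cost F + g.cost F)
  | _, _, .ite f g => 1 + (f.cost F + g.cost F)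
  | _, _, .loop body => F * (1 + body.cost F)
  | _, _, .eqIdent => F
  | _, _, .ask => F
  | _, _, _ => 1

/-- Loops are nested to a depth fixed by the program, and each contributes one factor `F`. -/
lemma Prog.exists_cost_polynomial {α β : Ty} (f : Prog α β) :
    ∃ q : ℕ[X], ∀ F, q.eval F = f.cost F := by
  induction f with
  | seq f g hf hg | pair f g hf hg | case f g hf hg | ite f g hf hg =>
    obtain ⟨p, hp⟩ := hf
    obtain ⟨q, hq⟩ := hg
    exact ⟨1 + (p + q), fun F => by simp [Prog.cost, hp, hq]⟩
  | loop f hf =>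
    obtain ⟨p, hp⟩ := hf
    exact ⟨X * (1 + p), fun F => by simp [Prog.cost, hp]⟩
  | eqIdent | ask => exact ⟨X, fun F => by simp [Prog.cost]⟩
  | _ => exact ⟨1, fun F => by simp [Prog.cost]⟩

/-! ### Timed execution compared with clock-free evaluation -/

lemma pmf_bind_congr {α β : Type} (p : PMF α) {f g : α → PMF β}
    (h : ∀ a ∈ p.support, f a = g a) : p.bind f = p.bind g := by
  ext b
  simp only [PMF.bind_apply]
  refine tsum_congr fun a => ?_
  by_cases ha : p a = 0
  · simp [ha]
  · rw [h a ((PMF.mem_support_iff _ _).2 ha)]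

/-- The timed computation `m` agrees with the computation `s` unless `s` can fail, and needs at
most the time `c`. -/
def Simulates {β : Type} (m : Timed β) (c : ℕ) (s : OptionT PMF β) : Prop :=
  none ∉ PMF.support s.run → ∀ t, c ≤ t →
    PMF.map (Option.map Prod.fst) (m.run t).run = s.run ∧
    ∀ x ∈ PMF.support (m.run t).run, ∃ b t', x = some (b, t') ∧ t ≤ t' + c

namespace Simulates

variable {α β : Type} {m : Timed β} {s : OptionT PMF β} {c c' : ℕ}

lemma mono (h : Simulates m c s) (hc : c ≤ c') : Simulates m c' s := fun hs t ht => by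
  obtain ⟨h1, h2⟩ := h hs t (hc.trans ht)
  refine ⟨h1, fun x hx => ?_⟩
  obtain ⟨b, t', rfl, h⟩ := h2 x hx
  exact ⟨b, t', rfl, by omega⟩

lemma pure (b : β) : Simulates (Pure.pure b) 0 (Pure.pure b) := fun _ t _ => by
  refine ⟨PMF.pure_map _ _, fun x hx => ⟨b, t, ?_, le_rfl⟩⟩
  exact (PMF.mem_support_pure_iff _ _).1 hx

lemma uniform [Fintype α] [Nonempty α] :
    Simulates (Timed.uniform α) 0 (OptionT.lift (PMF.uniformOfFintype α)) := fun _ t _ => by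
  have h : ((Timed.uniform α).run t).run =
      PMF.map (fun a => some (a, t)) (PMF.uniformOfFintype α) := by
    change PMF.bind (PMF.bind (PMF.uniformOfFintype α) fun a => PMF.pure (some a)) _ = _
    rw [PMF.bind_bind]
    simp only [PMF.pure_bind]
    rfl
  rw [h]
  refine ⟨by rw [PMF.map_comp]; rfl, fun x hx => ?_⟩
  obtain ⟨a, -, rfl⟩ := (PMF.mem_support_map_iff _ _ _).1 hx
  exact ⟨a, t, rfl, le_rfl⟩

/-- If the composite cannot fail, then neither can `s`, nor `r a` for any `a` in the support of `s`.
The lower bound on the time left after `m` is what allows `k a` to be run on it. -/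
lemma bind {m : Timed α} {s : OptionT PMF α} {k : α → Timed β} {r : α → OptionT PMF β}
    (h : Simulates m c s) (h' : ∀ a, Simulates (k a) c' (r a)) :
    Simulates (m >>= k) (c + c') (s >>= r) := fun hs t ht => by
  have e1 : ((m >>= k).run t).run = PMF.bind (m.run t).run (fun x => match x with
      | some (a, t') => ((k a).run t').run
      | none => PMF.pure none) := by
    change PMF.bind _ _ = _
    congr 1
    funext x
    cases x <;> rfl
  have e2 : (s >>= r).run = PMF.bind s.run (fun x => match x with
      | some a => (r a).run
      | none => PMF.pure none) := by
    change PMF.bind _ _ = _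
    congr 1
  rw [e2] at hs ⊢
  rw [e1]
  have hn : none ∉ PMF.support s.run := fun hn =>
    hs ((PMF.mem_support_bind_iff _ _ _).2 ⟨none, hn, by simp⟩)
  obtain ⟨h1, h2⟩ := h hn t (by omega)
  have key : ∀ a t', some (a, t') ∈ PMF.support (m.run t).run →
      PMF.map (Option.map Prod.fst) ((k a).run t').run = (r a).run ∧
      ∀ x ∈ PMF.support ((k a).run t').run, ∃ b t'', x = some (b, t'') ∧ t ≤ t'' + (c + c') := by
    intro a t' hat
    obtain ⟨b, t'', e, hle⟩ := h2 _ hat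
    obtain ⟨rfl, rfl⟩ : b = a ∧ t'' = t' := by simpa [eq_comm] using e
    have ha : some b ∈ PMF.support s.run := by
      rw [← h1]
      exact (PMF.mem_support_map_iff _ _ _).2 ⟨_, hat, rfl⟩
    obtain ⟨h3, h4⟩ := h' b
      (fun hn => hs ((PMF.mem_support_bind_iff _ _ _).2 ⟨some b, ha, hn⟩)) t'' (by omega)
    refine ⟨h3, fun x hx => ?_⟩
    obtain ⟨b', t', rfl, h⟩ := h4 x hx
    exact ⟨b', t', rfl, by omega⟩
  constructor
  · rw [PMF.map_bind, ← h1, PMF.bind_map]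
    refine pmf_bind_congr _ fun x hx => ?_
    obtain ⟨a, t', rfl, -⟩ := h2 x hx
    exact (key a t' hx).1
  · intro y hy
    obtain ⟨x, hx, hy⟩ := (PMF.mem_support_bind_iff _ _ _).1 hy
    obtain ⟨a, t', rfl, -⟩ := h2 x hx
    exact (key a t' hx).2 y hy

lemma spend_bind {k : ℕ} (h : Simulates m c s) :
    Simulates (spend k >>= fun _ => m) (k + c) s := fun hs t ht => by
  have e : ((spend k >>= fun _ => m).run t).run = (m.run (t - k)).run := by
    have : ((spend k).run t) = Pure.pure ((), t - k) := if_pos (by omega)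
    rw [StateT.run_bind, this]
    simp
  rw [e]
  obtain ⟨h1, h2⟩ := h hs (t - k) (by omega)
  refine ⟨h1, fun x hx => ?_⟩
  obtain ⟨b, t', rfl, h⟩ := h2 x hx
  exact ⟨b, t', rfl, by omega⟩

lemma spend_pure (k : ℕ) (b : β) : Simulates (spend k >>= fun _ => Pure.pure b) k (Pure.pure b) :=
  (pure b).spend_bind

lemma of_failure : Simulates m c failure := fun hs => by
  refine (hs ?_).elim
  change none ∈ PMF.support (PMF.pure none)
  simp

lemma spend_pure_ite {k F : ℕ} (b : β) : Simulates (spend k >>= fun _ => Pure.pure b) F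
    (if k ≤ F then Pure.pure b else failure) := by
  split_ifs with h
  · exact (spend_pure k b).mono h
  · exact of_failure

/-- Only the rounds `k` of the clock-free loop are paid for: when they run out it fails, and nothing
is left to show. -/
lemma loop {body : α → Timed (α ⊕ β)} {r : α → OptionT PMF (α ⊕ β)}
    (h : ∀ a, Simulates (body a) c (r a)) :
    ∀ (k n : ℕ) (a : α), k ≤ n → Simulates (Timed.loop body n a) (k * (1 + c)) (rounds r k a)
  | 0, _, _, _ => of_failure
  | k + 1, 0, _, hk => by omega
  | k + 1, n + 1, a, hk => by
    rw [Timed.loop, rounds]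
    refine (((h a).bind (c' := k * (1 + c)) fun x => ?_).spend_bind).mono (by grind)
    rcases x with a' | b
    · exact loop h k n a' (by omega)
    · exact (pure b).mono (Nat.zero_le _)

end Simulates

lemma Prog.simulates {𝔾 : PrimeGroup} (A : Adversary 𝔾) (F : ℕ) {α β : Ty} (f : Prog α β) :
    ∀ a, Simulates (f.eval A a) (f.cost F) (f.sem A F a) := by
  induction f with
  | seq f g hf hg =>
    intro a
    exact ((hf a).bind fun b => hg b).spend_bind
  | pair f g hf hg =>
    intro a
    exact ((hf a).bind fun b => (((hg a).bind fun c => .pure (b, c)).mono (by simp))).spend_bind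
  | case f g hf hg =>
    rintro ⟨c, a | b⟩
    · exact ((hf _).mono (by omega)).spend_bind
    · exact ((hg _).mono (by omega)).spend_bind
  | ite f g hf hg =>
    rintro ⟨c, _ | _⟩
    · exact ((hg _).mono (by omega)).spend_bind
    · exact ((hf _).mono (by omega)).spend_bind
  | loop body h =>
    intro a hs t ht
    refine Simulates.loop h F (t + 1) a ?_ hs t ht
    -- The timed loop has `t + 1` rounds at its disposal; this gives `F ≤ t`, so `F` rounds are
    -- available.
    have : F * 1 ≤ F * (1 + body.cost F) := Nat.mul_le_mul_left _ (by omega)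
    simp only [Prog.cost] at ht
    omega
  | uncons =>
    rintro (_ | ⟨a, l⟩)
    · exact .spend_pure _ _
    · exact .spend_pure _ _
  | eqIdent =>
    rintro ⟨a, b⟩
    exact .spend_pure_ite _
  | ask =>
    intro s
    exact .spend_pure_ite _
  | coin | sample => exact fun a => Simulates.uniform.spend_bind
  | _ => intro a; exact .spend_pure _ _

lemma Prog.runWithin_eq_sem {𝔾 : PrimeGroup} (A : Adversary 𝔾) (F : ℕ) {α β : Ty} (f : Prog α β)
    (a : α.Val A) (h : none ∉ PMF.support (f.sem A F a).run) {t : ℕ} (ht : f.cost F ≤ t) :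
    f.runWithin A t a = (f.sem A F a).run :=
  (f.simulates A F a h t ht).1

/-! ## The reduction -/

namespace Prog

/-- Inputs of the random oracle. -/
abbrev key : Ty := .prod .ident .point

/-- Tables of a simulated random oracle. An entry holds the input, the value, and the state of the
adversary when it caused the entry; the tail of the list is the table at that time. -/
abbrev table : Ty := .list (.prod key (.prod .scalar .state))

/-- The result of a run of the simulation: the final table, and the input of the random oracle and
the scalar that the adversary has output. -/
abbrev outcome : Ty := .prod table (.prod key .scalar)

/-- The public key, the table and the state of the adversary. -/
abbrev config : Ty := .prod .point (.prod table .state)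

/-- The coin and the scalars for one round of the simulation. -/
abbrev coins : Ty := .prod .bool (.prod .scalar .scalar)

/-- Evaluate `f` and extend the input by its value. -/
abbrev bind {α β γ : Ty} (f : Prog α β) (g : Prog (.prod α β) γ) : Prog α γ := seq (pair skip f) g

/-- One comparison in the search for an input in a table. -/
def findBody : Prog (.prod key table)
    (.sum (.prod key table) (.sum .unit (.prod (.prod .scalar .state) table))) :=
  bind (seq snd uncons) <| case (seq unit (seq inl inr)) <|
    let next := seq (pair (seq fst fst) (seq snd snd)) inl
    let found := seq (pair (seq snd (seq fst snd)) (seq snd snd)) (seq inr inr)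
    bind (seq (pair (seq fst (seq fst fst)) (seq snd (seq fst (seq fst fst)))) eqIdent) <|
      ite (bind (seq (pair (seq fst (seq fst snd)) (seq snd (seq fst (seq fst snd)))) eqPoint) <|
        ite found next) next

/-- Look up an input in a table. -/
def find : Prog (.prod key table) (.sum .unit (.prod (.prod .scalar .state) table)) :=
  loop findBody

/-- Answer an oracle query `k`, with the given scalar if it is new. -/
def oracle : Prog (.prod (.prod table .state) (.prod key .scalar)) (.prod table .scalar) :=
  bind (seq (pair (seq snd fst) (seq fst fst)) find) <| case
    (seq fst (pair (seq (pair (pair (seq snd fst) (pair (seq snd snd) (seq fst snd)))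
      (seq fst fst)) cons) (seq snd snd)))
    (pair (seq fst (seq fst fst)) (seq snd (seq fst fst)))

/-- The public key. -/
abbrev pk {α : Ty} : Prog (.prod (.prod config coins) α) .point := seq fst (seq fst fst)
/-- The table and the state of the adversary. -/
abbrev ts {α : Ty} : Prog (.prod (.prod config coins) α) (.prod table .state) :=
  seq fst (seq fst snd)
/-- The state of the adversary. -/
abbrev st {α : Ty} : Prog (.prod (.prod config coins) α) .state := seq ts snd
/-- The first random scalar. -/
abbrev sc {α : Ty} : Prog (.prod (.prod config coins) α) .scalar := seq fst (seq snd (seq snd fst))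
/-- The second random scalar. -/
abbrev sc' {α : Ty} : Prog (.prod (.prod config coins) α) .scalar :=
  seq fst (seq snd (seq snd snd))
/-- Continue with the given table and state. -/
abbrev proceed {α β : Ty} (t : Prog (.prod (.prod config coins) α) table)
    (s : Prog (.prod (.prod config coins) α) .state) :
    Prog (.prod (.prod config coins) α) (.sum config β) :=
  seq (pair pk (pair t s)) inl

/-- The answer of the simulation to an internal step. -/
def onWork : Prog (.prod (.prod config coins) .unit) (.sum config outcome) :=
  proceed (seq ts fst) (seq st tellDone)

/-- The answer of the simulation to the toss of a coin. -/
def onCoin : Prog (.prod (.prod config coins) .unit) (.sum config outcome) :=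
  proceed (seq ts fst) (seq (pair st (seq fst (seq snd fst))) tellBit)

/-- The answer of the simulation to the request for a random scalar. -/
def onScalar : Prog (.prod (.prod config coins) .unit) (.sum config outcome) :=
  proceed (seq ts fst) (seq (pair st sc) tellScalar)

/-- The answer of the simulation to a hash query. -/
def onHash : Prog (.prod (.prod config coins) key) (.sum config outcome) :=
  seq (pair fst (seq (pair ts (pair snd sc)) oracle)) <|
    proceed (seq snd fst) (seq (pair st (seq snd snd)) tellScalar)

/-- The answer of the simulation to a key query. -/
def onKeyQry : Prog (.prod (.prod config coins) .ident) (.sum config outcome) :=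
  -- The point is chosen to satisfy the verification equation for the scalars `r` (`sc`) and `x`
  -- (`sc'`); below, `r` is offered to the oracle as the hash value. The inverse of zero is zero, so
  -- `r = 0` gives the zero point.
  bind (seq (pair (seq sc inv)
    (seq (pair (seq (pair sc' gen) mulPoint) (seq pk negPoint)) addPoint)) mulPoint) <|
  seq (pair (seq fst fst) (pair (seq (pair (seq fst ts)
    (pair (pair (seq fst snd) snd) (seq fst sc))) (seq oracle fst)) snd)) <|
    proceed (seq snd fst) (seq (pair st (pair (seq snd snd) sc')) tellKey)

/-- The answer of the simulation to a verification query. -/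
def onKeyVer : Prog (.prod (.prod config coins) (.prod .ident (.prod .point .scalar)))
    (.sum config outcome) :=
  seq (pair fst (pair (seq (pair ts (pair (pair (seq snd fst) (seq snd (seq snd fst))) sc)) oracle)
    (seq snd snd))) <|
  seq (pair fst (pair (seq snd (seq fst fst)) (seq (pair
    (seq (pair (seq snd (seq snd snd)) gen) mulPoint)
    (seq (pair (seq (pair (seq snd (seq fst snd)) (seq snd (seq snd fst))) mulPoint) pk)
      addPoint)) eqPoint))) <|
    proceed (seq snd fst) (seq (pair st (seq snd snd)) tellBit)

/-- The reaction of the simulation to the output of the adversary. -/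
def onOutput : Prog (.prod (.prod config coins) (.prod .ident (.prod .point .scalar)))
    (.sum config outcome) :=
  -- Asking the oracle about the output ensures that its hash input has an entry, hence a state to
  -- rewind to.
  seq (pair (seq (pair ts (pair (pair (seq snd fst) (seq snd (seq snd fst))) sc))
    (seq oracle fst)) (pair (pair (seq snd fst) (seq snd (seq snd fst))) (seq snd (seq snd snd))))
    inr

/-- One transition of the simulation. -/
def step : Prog (.prod config coins) (.sum config outcome) :=
  bind (seq (seq fst (seq snd snd)) ask) <|
    case onWork <| case onCoin <| case onScalar <| case onHash <| case onKeyQry <|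
      case onKeyVer onOutput

/-- Run the adversary from a configuration in a simulated experiment. -/
def simulate : Prog config outcome :=
  loop (bind (pair coin (pair sample sample)) step)

/-- The discrete logarithm of the public key, from the scalars and hash values of two forgeries
`((x, h), (x', h'))` with the same point. -/
def extract : Prog (.prod (.prod .scalar .scalar) (.prod .scalar .scalar)) .scalar :=
  seq (pair (seq fst fst) (seq (seq (pair (seq fst snd) (seq (pair
    (seq (pair (seq fst fst) (seq (seq snd fst) neg)) add)
    (seq (seq (pair (seq fst snd) (seq (seq snd snd) neg)) add) inv)) mul)) mul) neg)) add

/-- The second run of the simulation, on `(((X, Y), outcome), ((h, s), tail))`. -/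
def second : Prog (.prod (.prod (.prod .point .point) outcome) (.prod (.prod .scalar .state) table))
    .point :=
  -- Restart from the recorded state with the table below the entry: the transition that created the
  -- entry is repeated with new coins.
  bind (seq (pair (seq fst (seq fst fst)) (pair (seq snd snd) (seq snd (seq fst snd))))
    simulate) <|
  -- The hash input of the first output is looked up in the second table, without a check that the
  -- second output uses it. A bad second run only yields a useless point, and `gen` is an arbitrary
  -- default.
  bind (seq (pair (seq fst (seq fst (seq snd (seq snd fst)))) (seq snd fst)) find) <|
  case gen <|
  seq (pair (seq (pair
      (pair (seq fst (seq fst (seq fst (seq snd (seq snd snd)))))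
        (seq fst (seq fst (seq snd (seq fst fst)))))
      (pair (seq fst (seq snd (seq snd snd))) (seq snd (seq fst fst)))) extract)
    (seq fst (seq fst (seq fst (seq fst snd))))) mulPoint

/-- Run the adversary, run it again from the query that belongs to its output, and compute the
private key from the two forgeries. -/
def fork : Prog (.prod .point .point) .point :=
  bind (seq (pair fst (pair nil (seq fst start))) simulate) <|
  bind (seq (pair (seq snd (seq snd fst)) (seq snd fst)) find) <|
  case gen <| seq (pair (seq fst skip) snd) second

/-- The algorithm for the Diffie–Hellman problem: guess the solution, or find the discrete
logarithm of the first point. -/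
def cdh : Prog (.prod .point .point) .point :=
  bind coin (ite (seq (pair sample gen) mulPoint) fork)

end Prog

/-! ## The simulation as a random process -/

section simulation

variable {𝔾 : PrimeGroup} (A : Adversary 𝔾)

/-- Tables of the simulated random oracle. -/
abbrev SimTable : Type := List ((Ident × 𝔾.Point) × (𝔾.Scalar × A.State))

/-- Outcomes of the simulation. -/
abbrev Outcome : Type := SimTable A × ((Ident × 𝔾.Point) × 𝔾.Scalar)

variable {A}

open Classical in
/-- The value and the state at an input of the random oracle, and the table below it. -/
def SimTable.find (k : Ident × 𝔾.Point) :
    SimTable A → Option ((𝔾.Scalar × A.State) × SimTable A)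
  | [] => none
  | e :: tbl => if k = e.1 then some (e.2, tbl) else SimTable.find k tbl

/-- The answer to the oracle query `k`, which is `r` if the query is new. -/
def SimTable.query (tbl : SimTable A) (s : A.State) (k : Ident × 𝔾.Point) (r : 𝔾.Scalar) :
    SimTable A × 𝔾.Scalar :=
  match tbl.find k with
  | none => ((k, (r, s)) :: tbl, r)
  | some e => (tbl, e.1.1)

open Classical in
/-- One transition of the simulation, with the given coin and scalars. -/
def simStep (D : 𝔾.Point) (tbl : SimTable A) (s : A.State) (c : Bool) (r x : 𝔾.Scalar) :
    SimTable A × A.State ⊕ Outcome A :=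
  match A.ask s with
  | .work => .inl (tbl, A.tell s .done)
  | .coin => .inl (tbl, A.tell s (.bit c))
  | .scalar => .inl (tbl, A.tell s (.scalar r))
  | .hash id U => .inl ((tbl.query s (id, U) r).1, A.tell s (.scalar (tbl.query s (id, U) r).2))
  | .keyQry id =>
      .inl ((tbl.query s (id, 𝔾.mul r⁻¹ (𝔾.mul x 𝔾.gen + -D)) r).1,
        A.tell s (.key (𝔾.mul r⁻¹ (𝔾.mul x 𝔾.gen + -D)) x))
  | .keyVer id U y =>
      .inl ((tbl.query s (id, U) r).1, A.tell s
        (.bit (decide (𝔾.mul y 𝔾.gen = 𝔾.mul (tbl.query s (id, U) r).2 U + D))))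
  | .output id U y => .inr ((tbl.query s (id, U) r).1, ((id, U), y))

/-- The coin and the scalars for one transition of the simulation. -/
def withCoins {α : Type} (k : Bool → 𝔾.Scalar → 𝔾.Scalar → PMF α) : PMF α :=
  (PMF.uniformOfFintype Bool).bind fun c => (PMF.uniformOfFintype 𝔾.Scalar).bind fun r =>
    (PMF.uniformOfFintype 𝔾.Scalar).bind fun x => k c r x

/-- The outcome of at most `n` transitions of the simulation. -/
def simulation (D : 𝔾.Point) : ℕ → SimTable A × A.State ⊕ Outcome A → PMF (Option (Outcome A))
  | _, .inr o => PMF.pure (some o)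
  | 0, .inl _ => PMF.pure none
  | n + 1, .inl σ => withCoins fun c r x => simulation D n (simStep D σ.1 σ.2 c r x)

/-- The machine stops after at most `n` transitions, none of which takes more time than `B`. -/
def Adversary.Bounded {𝔾 : PrimeGroup} (A : Adversary 𝔾) (B : ℕ) : ℕ → A.State → Prop
  | 0, _ => False
  | n + 1, s => (A.ask s).time ≤ B ∧
    match A.ask s with
    | .work => A.Bounded B n (A.tell s .done)
    | .coin => ∀ b, A.Bounded B n (A.tell s (.bit b))
    | .scalar => ∀ h, A.Bounded B n (A.tell s (.scalar h))
    | .hash _ _ => ∀ h, A.Bounded B n (A.tell s (.scalar h))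
    | .keyQry _ => ∀ U x, A.Bounded B n (A.tell s (.key U x))
    | .keyVer _ _ _ => ∀ b, A.Bounded B n (A.tell s (.bit b))
    | .output _ _ _ => True

lemma Adversary.Bounded.mono {B : ℕ} : ∀ {n m : ℕ} {s : A.State}, A.Bounded B n s → n ≤ m →
    A.Bounded B m s
  | 0, _, _, h, _ => h.elim
  | n + 1, 0, _, _, hm => by omega
  | n + 1, m + 1, s, h, hm => by
    have hm : n ≤ m := by omega
    refine ⟨h.1, ?_⟩
    have h2 := h.2
    revert h2
    cases A.ask s with
    | work => exact fun h2 => h2.mono hm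
    | output => exact fun _ => trivial
    | keyQry => exact fun h2 U x => (h2 U x).mono hm
    | _ => exact fun h2 b => (h2 b).mono hm

/-- Every transition takes at least one unit, so a bound on the time also bounds the number of
transitions. The bound `B` on a single transition stays fixed while the number of transitions left
decreases. -/
lemma Adversary.HaltsWithin.bounded {t qk qh : ℕ} {s : A.State} (h : A.HaltsWithin t qk qh s) :
    ∀ {B : ℕ}, t ≤ B → A.Bounded B t s := by
  have key : ∀ {t B : ℕ} {s : A.State}, t + (A.ask s).time ≤ B →
      A.Bounded B (t + 1) s → A.Bounded B (t + (A.ask s).time) s := by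
    intro t B s _ h'
    refine h'.mono ?_
    have : 1 ≤ (A.ask s).time := by cases A.ask s <;> simp [Request.time]
    omega
  induction h with
  | work hs _ ih => exact fun hB => key hB ⟨by omega, by rw [hs]; exact ih (by omega)⟩
  | coin hs _ ih => exact fun hB => key hB ⟨by omega, by rw [hs]; exact fun b => ih b (by omega)⟩
  | scalar hs _ ih =>
    exact fun hB => key hB ⟨by omega, by rw [hs]; exact fun b => ih b (by omega)⟩
  | hash _ _ hs _ ih =>
    exact fun hB => key hB ⟨by omega, by rw [hs]; exact fun b => ih b (by omega)⟩
  | keyQry _ hs _ ih =>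
    exact fun hB => key hB ⟨by omega, by rw [hs]; exact fun U x => ih U x (by omega)⟩
  | keyVer _ _ _ hs _ ih =>
    exact fun hB => key hB ⟨by omega, by rw [hs]; exact fun b => ih b (by omega)⟩
  | output _ _ _ hs => exact fun hB => key hB ⟨by omega, by rw [hs]; trivial⟩

/-- The tables that occur in the simulation: there are at most `m` entries, with short identities
and with states from which the adversary stops. -/
def SimTable.Good (B m : ℕ) (tbl : SimTable A) : Prop :=
  tbl.length ≤ m ∧ ∀ e ∈ tbl, e.1.1.length < B ∧ A.Bounded B B e.2.2

lemma SimTable.Good.find {B m : ℕ} {k : Ident × 𝔾.Point} {e} :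
    ∀ {tbl : SimTable A}, tbl.Good B m → tbl.find k = some e →
      A.Bounded B B e.1.2 ∧ SimTable.Good B m e.2
  | [], _, h => by simp [SimTable.find] at h
  | e' :: tbl, hg, h => by
    have hg' : SimTable.Good B m tbl :=
      ⟨by have := hg.1; simp at this; omega, fun e he => hg.2 e (by simp [he])⟩
    rw [SimTable.find] at h
    split_ifs at h with hk
    · obtain rfl : (e'.2, tbl) = e := by simpa using h
      exact ⟨(hg.2 e' (by simp)).2, hg'⟩
    · exact hg'.find h

/-- The configurations and outcomes that occur when at most `n` transitions are left. -/
def Reachable (B m n : ℕ) : SimTable A × A.State ⊕ Outcome A → Prop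
  | .inl (tbl, s) => A.Bounded B n s ∧ n ≤ B ∧ ∃ l, l + n = m ∧ tbl.Good B l
  | .inr (tbl, (k, _)) => tbl.Good B m ∧ k.1.length < B

lemma SimTable.Good.query {B m : ℕ} {tbl : SimTable A} (h : tbl.Good B m) {s : A.State}
    (hs : A.Bounded B B s) {k : Ident × 𝔾.Point} (hk : k.1.length < B) (r : 𝔾.Scalar) :
    (tbl.query s k r).1.Good B (m + 1) := by
  unfold SimTable.query
  split
  · refine ⟨by simpa using h.1, fun e he => ?_⟩
    rcases List.mem_cons.1 he with rfl | he
    · exact ⟨hk, hs⟩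
    · exact h.2 e he
  · exact ⟨h.1.trans (by omega), h.2⟩

lemma SimTable.Good.mono {B m m' : ℕ} {tbl : SimTable A} (h : tbl.Good B m) (hm : m ≤ m') :
    tbl.Good B m' := ⟨h.1.trans hm, h.2⟩

/-- A transition adds at most one entry and uses up one transition, so the bound on the entries plus
the transitions left stays at `m`. A new entry records the current state, which is bounded, and an
identity shorter than the time of the request. -/
lemma Reachable.simStep {B m n : ℕ} {tbl : SimTable A} {s : A.State}
    (h : Reachable B m (n + 1) (.inl (tbl, s))) (D : 𝔾.Point) (c : Bool) (r x : 𝔾.Scalar) :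
    Reachable B m n (simStep D tbl s c r x) := by
  obtain ⟨hs, hn, l, hl, ht⟩ := h
  have hB := hs.mono hn
  have htime := hs.1
  have hs := hs.2
  have hq : ∀ {k : Ident × 𝔾.Point}, k.1.length < B → ∀ r, (tbl.query s k r).1.Good B (l + 1) :=
    fun hk r => ht.query hB hk r
  have ht' := ht.mono (show l ≤ l + 1 by omega)
  revert hs htime
  unfold SelfCert.simStep
  cases A.ask s with
  | work => exact fun _ hs => ⟨hs, by omega, l + 1, by omega, ht'⟩
  | coin => exact fun _ hs => ⟨hs c, by omega, l + 1, by omega, ht'⟩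
  | scalar => exact fun _ hs => ⟨hs r, by omega, l + 1, by omega, ht'⟩
  | hash id U =>
    exact fun hi hs => ⟨hs _, by omega, l + 1, by omega, hq (by simp [Request.time] at hi; grind) _⟩
  | keyQry id =>
    exact fun hi hs => ⟨hs _ _, by omega, l + 1, by omega,
      hq (by simp [Request.time] at hi; grind) _⟩
  | keyVer id U y =>
    exact fun hi hs => ⟨hs _, by omega, l + 1, by omega, hq (by simp [Request.time] at hi; grind) _⟩
  | output id U y =>
    intro hi _
    have hi : id.length < B := by simp [Request.time] at hi; omega
    exact ⟨(hq hi _).mono (by omega), hi⟩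

end simulation

/-! ### The reduction as a program computes the abstract random process -/

lemma run_bind_eq {α β : Type} (m : OptionT PMF α) (k : α → OptionT PMF β) :
    (m >>= k).run = m.run.bind fun o => match o with
      | some a => (k a).run
      | none => PMF.pure none := by
  change PMF.bind _ _ = _
  congr 1

lemma run_lift_bind {α β : Type} (p : PMF α) (k : α → OptionT PMF β) :
    (OptionT.lift p >>= k).run = p.bind fun a => (k a).run := by
  rw [run_bind_eq]
  change PMF.bind (PMF.bind p fun a => PMF.pure (some a)) _ = _
  simp only [PMF.bind_bind, PMF.pure_bind]

lemma run_pure_eq {α : Type} (a : α) : (pure a : OptionT PMF α).run = PMF.pure (some a) := rfl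

namespace Prog

variable {𝔾 : PrimeGroup} {A : Adversary 𝔾} {F : ℕ}

open Classical in
lemma sem_findBody_cons {k : Ident × 𝔾.Point} {e : (Ident × 𝔾.Point) × (𝔾.Scalar × A.State)}
    {tbl : SimTable A} (h : 1 + k.1.length + e.1.1.length ≤ F) :
    findBody.sem A F (k, e :: tbl) =
      pure (if k = e.1 then .inr (.inr (e.2, tbl)) else .inl (k, tbl)) := by
  obtain ⟨k1, k2⟩ := k
  obtain ⟨⟨e1, e2⟩, e3⟩ := e
  simp only at h
  by_cases h1 : k1 = e1
  · subst h1
    by_cases h2 : k2 = e2 <;> simp [findBody, sem, h, h2]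
  · simp [findBody, sem, h, h1]

/-- The result of a search as a value of a program. -/
def findVal (o : Option ((𝔾.Scalar × A.State) × SimTable A)) :
    (Ty.sum .unit (.prod (.prod .scalar .state) table)).Val A :=
  match o with
  | none => .inl ()
  | some e => .inr e

lemma rounds_findBody {k : Ident × 𝔾.Point} :
    ∀ {tbl : SimTable A} {n : ℕ}, (∀ e ∈ tbl, 1 + k.1.length + e.1.1.length ≤ F) →
      tbl.length < n → rounds (fun a => findBody.sem A F a) n (k, tbl) = pure (findVal (tbl.find k))
  | [], n + 1, _, _ => by
    simp [rounds, findBody, sem, SimTable.find, findVal]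
  | e :: tbl, n + 1, h, hn => by
    rw [rounds, sem_findBody_cons (h e (by simp)), SimTable.find]
    split_ifs
    · simp [findVal]
    · rw [pure_bind]
      exact rounds_findBody (fun e he => h e (by simp [he])) (by simpa using hn)

/-- Both identities in a comparison are shorter than `B`, so it takes less than `2 * B`. The search
may need one round more than there are entries, hence `m < F`. -/
lemma sem_find {B m : ℕ} {k : Ident × 𝔾.Point} {tbl : SimTable A} (h : tbl.Good B m)
    (hk : k.1.length < B) (hB : 2 * B ≤ F) (hm : m < F) :
    find.sem A F (k, tbl) = pure (findVal (tbl.find k)) :=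
  rounds_findBody (fun e he => by have := (h.2 e he).1; omega) (h.1.trans_lt hm)

lemma sem_oracle {B m : ℕ} {k : Ident × 𝔾.Point} {tbl : SimTable A} (h : tbl.Good B m)
    (hk : k.1.length < B) (hB : 2 * B ≤ F) (hm : m < F) (s : A.State) (r : 𝔾.Scalar) :
    oracle.sem A F ((tbl, s), (k, r)) = pure (tbl.query s k r) := by
  simp only [oracle, bind, sem, pure_bind, sem_find h hk hB hm, SimTable.query]
  cases tbl.find k <;> simp [findVal]

/-- Values of the result of a transition. -/
def stepVal (D : 𝔾.Point) (v : SimTable A × A.State ⊕ Outcome A) :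
    (Ty.sum config outcome).Val A :=
  match v with
  | .inl σ => .inl (D, σ)
  | .inr o => .inr o

lemma sem_step {B m n : ℕ} (hB : 2 * B ≤ F) (hm : m < F) {D : 𝔾.Point} {tbl : SimTable A}
    {s : A.State} (h : Reachable B m n (.inl (tbl, s))) (c : Bool) (r x : 𝔾.Scalar) :
    step.sem A F ((D, (tbl, s)), (c, (r, x))) = pure (stepVal D (simStep D tbl s c r x)) := by
  obtain ⟨hs, hn, l, hl, ht⟩ := h
  have hs : (A.ask s).time ≤ B := by
    cases n with
    | zero => exact hs.elim
    | succ => exact hs.1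
  have ho : ∀ (k : Ident × 𝔾.Point) r, 1 + k.1.length ≤ B →
      oracle.sem A F ((tbl, s), (k, r)) = pure (tbl.query s k r) :=
    fun k r hk => sem_oracle ht (by omega) hB (by omega) s r
  have hF : (A.ask s).time ≤ F := by omega
  simp only [step, bind, sem, pure_bind, if_pos hF, simStep]
  revert hs
  cases A.ask s with
  | work | coin | scalar =>
    intro _
    simp [Request.toVal, sem, onWork, onCoin, onScalar, stepVal]
  | hash id U =>
    intro hs
    simp [Request.toVal, sem, onHash, ho (id, U) _ hs, stepVal]
  | keyQry id =>
    intro hs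
    simp [Request.toVal, sem, onKeyQry, ho (id, _) _ hs, stepVal]
  | keyVer id U y =>
    intro hs
    simp [Request.toVal, sem, onKeyVer, ho (id, U) _ hs, stepVal]
  | output id U y =>
    intro hs
    simp [Request.toVal, sem, onOutput, ho (id, U) _ hs, stepVal]

/-- One round of the simulation, on a reachable configuration. -/
lemma sem_round {B m n : ℕ} (hB : 2 * B ≤ F) (hm : m < F) {D : 𝔾.Point} {tbl : SimTable A}
    {s : A.State} (h : Reachable B m n (.inl (tbl, s))) :
    (bind (pair coin (pair sample sample)) step).sem A F (D, (tbl, s)) =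
      OptionT.mk (withCoins fun c r x => PMF.pure (some (stepVal D (simStep D tbl s c r x)))) := by
  have hstep := sem_step hB hm (D := D) h
  simp only [sem, pure_bind, bind_assoc, hstep]
  apply OptionT.ext
  simp only [run_lift_bind, run_pure_eq, OptionT.run_mk, withCoins]

lemma rounds_simulate {B : ℕ} (hB : 2 * B ≤ F) {D : 𝔾.Point} {m : ℕ} (hm : m < F) :
    ∀ {n : ℕ} {k : ℕ} {σ : SimTable A × A.State}, Reachable B m n (.inl σ) → n ≤ k →
      (rounds (fun a => (bind (pair coin (pair sample sample)) step).sem A F a) k (D, σ)).run =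
        simulation D k (.inl σ)
  | 0, _, _, h, _ => h.1.elim
  | n + 1, 0, _, _, hk => by omega
  | n + 1, k + 1, (tbl, s), h, hk => by
    rw [rounds, sem_round hB hm h, run_bind_eq]
    simp only [OptionT.run_mk, withCoins, PMF.bind_bind, PMF.pure_bind, simulation]
    congr! 6 with c r x
    have h' := h.simStep D c r x
    revert h'
    cases simStep D tbl s c r x with
    | inl σ => exact fun h' => rounds_simulate hB hm h' (by omega)
    | inr o => intro _; rw [simulation.eq_def]; rfl

/-- A bounded adversary stops before the rounds run out, so the simulation never fails; this is the
hypothesis under which the clock can be ignored. -/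
lemma simulation_support {B : ℕ} {D : 𝔾.Point} {m : ℕ} :
    ∀ {n k : ℕ} {v : SimTable A × A.State ⊕ Outcome A}, Reachable B m n v → n ≤ k →
      ∀ o ∈ PMF.support (simulation D k v), ∃ o', o = some o' ∧ Reachable B m 0 (.inr o')
  | n, k, .inr o', h, _ => by
    intro o ho
    rw [simulation.eq_def] at ho
    exact ⟨o', by simpa using ho, h⟩
  | 0, _, .inl σ, h, _ => h.1.elim
  | n + 1, 0, _, _, hk => by omega
  | n + 1, k + 1, .inl σ, h, hk => by
    intro o ho
    simp only [simulation, withCoins, PMF.mem_support_bind_iff] at ho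
    obtain ⟨c, -, r, -, x, -, ho⟩ := ho
    exact simulation_support (h.simStep D c r x) (by omega) o ho

lemma sem_simulate {B : ℕ} (hB : 2 * B ≤ F) {D : 𝔾.Point} {m n : ℕ} (hm : m < F)
    {σ : SimTable A × A.State} (h : Reachable B m n (.inl σ)) (hn : n ≤ F) :
    (simulate.sem A F (D, σ)).run = simulation D F (.inl σ) :=
  rounds_simulate hB hm h hn

/-- The discrete logarithm of the public key, from two forgeries with the same point. -/
def dlog (x h x' h' : 𝔾.Scalar) : 𝔾.Scalar := x + -(h * ((x + -x') * (h + -h')⁻¹))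

/-- The second run of the simulation and the computation of the solution. -/
def secondPMF (A : Adversary 𝔾) (F : ℕ) (D Y : 𝔾.Point) (k : Ident × 𝔾.Point) (x h : 𝔾.Scalar)
    (s : A.State) (tbl : SimTable A) : PMF (Option 𝔾.Point) :=
  (simulation D F (.inl (tbl, s))).bind fun o => PMF.pure (o.map fun o =>
    match SimTable.find k o.1 with
    | none => 𝔾.gen
    | some e => 𝔾.mul (dlog x h o.2.2 e.1.1) Y)

/-- The two runs of the simulation. -/
def forkPMF (A : Adversary 𝔾) (F : ℕ) (D Y : 𝔾.Point) : PMF (Option 𝔾.Point) :=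
  (simulation D F (.inl (([] : SimTable A), A.init D))).bind fun o => match o with
    | none => PMF.pure none
    | some o => match SimTable.find o.2.1 o.1 with
      | none => PMF.pure (some 𝔾.gen)
      | some e => secondPMF A F D Y o.2.1 o.2.2 e.1.1 e.1.2 e.2

/-- The second run starts from a table with up to `m` entries and adds at most `B`. With `m = B`
after the first run, `2 * B < F` is just enough for searching the result. -/
lemma sem_second {B m : ℕ} (hB : 2 * B < F) (hm : m + B < F) {D Y : 𝔾.Point}
    {k : Ident × 𝔾.Point} (hk : k.1.length < B) (x h : 𝔾.Scalar) {s : A.State}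
    {t tbl : SimTable A} (hs : A.Bounded B B s) (ht : tbl.Good B m) :
    (second.sem A F (((D, Y), (t, (k, x))), ((h, s), tbl))).run = secondPMF A F D Y k x h s tbl ∧
      none ∉ PMF.support (second.sem A F (((D, Y), (t, (k, x))), ((h, s), tbl))).run := by
  have hr : Reachable B (m + B) B (.inl (tbl, s)) := ⟨hs, le_rfl, m, rfl, ht⟩
  have hsim := sem_simulate hB.le (D := D) hm hr (by omega)
  have hsupp := simulation_support (D := D) hr (show B ≤ F by omega)
  have e : (second.sem A F (((D, Y), (t, (k, x))), ((h, s), tbl))).run =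
      secondPMF A F D Y k x h s tbl := by
    simp only [second, bind, sem, pure_bind, bind_assoc]
    rw [run_bind_eq, hsim, secondPMF]
    refine pmf_bind_congr _ fun o ho => ?_
    obtain ⟨⟨t', k', x'⟩, rfl, ht', -⟩ := hsupp o ho
    simp only [pure_bind, sem_find ht' hk hB.le hm, Option.map_some]
    cases SimTable.find k t' with
    | none => rfl
    | some e =>
      simp [findVal, sem, extract, dlog]
      rfl
  refine ⟨e, fun hn => ?_⟩
  rw [e, secondPMF, PMF.mem_support_bind_iff] at hn
  obtain ⟨o, ho, hn⟩ := hn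
  obtain ⟨o, rfl, -⟩ := hsupp o ho
  simp at hn

lemma sem_fork {B : ℕ} (hB : 2 * B < F) {D Y : 𝔾.Point} (hs : A.Bounded B B (A.init D)) :
    (fork.sem A F (D, Y)).run = forkPMF A F D Y ∧
      none ∉ PMF.support (fork.sem A F (D, Y)).run := by
  have hr : Reachable B B B (.inl (([] : SimTable A), A.init D)) :=
    ⟨hs, le_rfl, 0, by simp, by simp [SimTable.Good]⟩
  have hsim := sem_simulate hB.le (D := D) (by omega) hr (by omega)
  have hsupp := simulation_support (D := D) hr (show B ≤ F by omega)
  have e : (fork.sem A F (D, Y)).run = forkPMF A F D Y := by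
    simp only [fork, bind, sem, pure_bind, bind_assoc]
    rw [run_bind_eq, hsim, forkPMF]
    refine pmf_bind_congr _ fun o ho => ?_
    obtain ⟨⟨t, k, x⟩, rfl, ht, hk⟩ := hsupp o ho
    simp only [pure_bind, sem_find ht hk hB.le (show B < F by omega)]
    cases h : SimTable.find k t with
    | none => rfl
    | some e =>
      obtain ⟨he, ht'⟩ := ht.find h
      simp only [findVal]
      exact (sem_second hB (by omega) hk x e.1.1 he ht').1
  refine ⟨e, fun hn => ?_⟩
  rw [e, forkPMF, PMF.mem_support_bind_iff] at hn
  obtain ⟨o, ho, hn⟩ := hn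
  obtain ⟨⟨t, k, x⟩, rfl, ht, hk⟩ := hsupp o ho
  revert hn
  simp only
  cases h : SimTable.find k t with
  | none => simp
  | some e =>
    obtain ⟨he, ht'⟩ := ht.find h
    obtain ⟨e1, e2⟩ := sem_second (Y := Y) (D := D) (t := t) hB (by omega) hk x e.1.1 he ht'
    rw [e1] at e2
    exact e2

/-- The result of the algorithm. -/
def cdhPMF (A : Adversary 𝔾) (F : ℕ) (D Y : 𝔾.Point) : PMF (Option 𝔾.Point) :=
  (PMF.uniformOfFintype Bool).bind fun c => match c with
    | true => (PMF.uniformOfFintype 𝔾.Scalar).bind fun r => PMF.pure (some (𝔾.mul r 𝔾.gen))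
    | false => forkPMF A F D Y

lemma sem_cdh {B : ℕ} (hB : 2 * B < F) {D Y : 𝔾.Point} (hs : A.Bounded B B (A.init D)) :
    (cdh.sem A F (D, Y)).run = cdhPMF A F D Y ∧
      none ∉ PMF.support (cdh.sem A F (D, Y)).run := by
  obtain ⟨e1, e2⟩ := sem_fork hB (Y := Y) hs
  have e : (cdh.sem A F (D, Y)).run = cdhPMF A F D Y := by
    simp only [cdh, bind, sem, pure_bind, bind_assoc]
    rw [run_lift_bind, cdhPMF]
    congr 1
    funext c
    cases c
    · exact e1
    · simp only [run_lift_bind, run_pure_eq]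
  refine ⟨e, fun hn => ?_⟩
  rw [e, cdhPMF, PMF.mem_support_bind_iff] at hn
  obtain ⟨c, -, hn⟩ := hn
  cases c
  · exact e2 (e1 ▸ hn)
  · simp at hn

end Prog

/-! ## Scalars and points -/

section group

variable {𝔾 : PrimeGroup}

/-- The order `N` of the group kills every point. Equations between points thus become linear
algebra over the field `ℤ_N`. -/
instance : Module 𝔾.Scalar 𝔾.Point :=
  AddCommGroup.zmodModule (n := 𝔾.N) fun P => by rw [← 𝔾.card_eq]; exact card_nsmul_eq_zero'

lemma mul_eq_smul (x : 𝔾.Scalar) (P : 𝔾.Point) : 𝔾.mul x P = x • P := by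
  rw [PrimeGroup.mul, ← Nat.cast_smul_eq_nsmul 𝔾.Scalar, ZMod.natCast_zmod_val]

lemma smul_gen_bijective : Function.Bijective fun x : 𝔾.Scalar => x • 𝔾.gen := by
  have hs : Function.Surjective fun x : 𝔾.Scalar => x • 𝔾.gen := fun P => by
    obtain ⟨n, hn⟩ := AddSubgroup.mem_zmultiples_iff.1 (𝔾.gen_generates P)
    exact ⟨(n : 𝔾.Scalar), by simpa [Int.cast_smul_eq_zsmul] using hn⟩
  have : Finite 𝔾.Point := Nat.finite_of_card_ne_zero (by rw [𝔾.card_eq]; exact 𝔾.prime.ne_zero)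
  refine (Nat.bijective_iff_surjective_and_card _).2 ⟨hs, ?_⟩
  rw [𝔾.card_eq, Nat.card_zmod]

lemma smul_gen_inj {x y : 𝔾.Scalar} : x • 𝔾.gen = y • 𝔾.gen ↔ x = y :=
  smul_gen_bijective.1.eq_iff

/-- With `U = u × G` the equations read `x = h * u + d` and `x' = h' * u + d`; subtract to find `u`,
then `d = x - h * u`. -/
lemma dlog_eq {d x h x' h' : 𝔾.Scalar} {U : 𝔾.Point}
    (e : 𝔾.mul x 𝔾.gen = 𝔾.mul h U + 𝔾.mul d 𝔾.gen)
    (e' : 𝔾.mul x' 𝔾.gen = 𝔾.mul h' U + 𝔾.mul d 𝔾.gen) (hh : h' ≠ h) :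
    Prog.dlog x h x' h' = d := by
  obtain ⟨u, rfl⟩ := smul_gen_bijective.2 U
  simp only [mul_eq_smul, smul_smul, ← add_smul, smul_gen_inj] at e e'
  subst e e'
  have : h - h' ≠ 0 := sub_ne_zero.2 hh.symm
  rw [Prog.dlog, show h * u + d + -(h' * u + d) = u * (h - h') by ring, ← sub_eq_add_neg h,
    mul_assoc, mul_inv_cancel₀ this]
  ring

end group

/-! ## Averages -/

section average

lemma expect_fst {α β : Type} [Fintype α] [Fintype β] [Nonempty β] (f : α → ℝ) :
    (𝔼 p : α × β, f p.1) = 𝔼 a, f a := by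
  rw [← Finset.univ_product_univ, Finset.expect_product]
  simp

lemma expect_snd {α β : Type} [Fintype α] [Fintype β] [Nonempty α] (f : β → ℝ) :
    (𝔼 p : α × β, f p.2) = 𝔼 a, f a := by
  rw [← Finset.univ_product_univ, Finset.expect_product]
  simp

/-- The variance is nonnegative. -/
lemma sq_expect_le {α : Type} [Fintype α] [Nonempty α] (f : α → ℝ) :
    (𝔼 a, f a) ^ 2 ≤ 𝔼 a, f a ^ 2 := by
  set m := 𝔼 a, f a with hm
  have h : 0 ≤ 𝔼 a, (f a - m) ^ 2 := Finset.expect_nonneg fun a _ => sq_nonneg _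
  have e : (𝔼 a, (f a - m) ^ 2) = (𝔼 a, f a ^ 2) - m ^ 2 := by
    have : ∀ a, (f a - m) ^ 2 = (f a ^ 2 - 2 * m * f a) + m ^ 2 := fun a => by ring
    simp only [this]
    rw [Finset.expect_add_distrib, Finset.expect_sub_distrib, ← Finset.mul_expect, ← hm,
      Fintype.expect_const]
    ring
  linarith

lemma expect_single {α : Type} [Fintype α] [DecidableEq α] (a : α) (y : ℝ) :
    (𝔼 b, if b = a then y else 0) = y / Fintype.card α := by
  rw [Fintype.expect_eq_sum_div_card, Finset.sum_ite_eq' Finset.univ a]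
  simp

/-- Two independent samples from a distribution on `[0, 1]`, indexed by different values. -/
lemma sq_expect_sub_le {α : Type} [Fintype α] [Nonempty α] [DecidableEq α] {p p' : α → ℝ}
    (h0 : ∀ a, 0 ≤ p a) (h1 : ∀ a, p a ≤ 1) (hp : ∀ a, p a ≤ p' a) :
    (𝔼 a, p a) ^ 2 - 1 / Fintype.card α ≤ 𝔼 a, p a * 𝔼 b, if b ≠ a then p' b else 0 := by
  -- Leaving out the diagonal term `b = a` loses `p a / card α`, and `p a * p a ≤ 1`.
  have key : ∀ a, p a * (𝔼 b, p b) - 1 / Fintype.card α ≤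
      p a * 𝔼 b, if b ≠ a then p' b else 0 := by
    intro a
    have : (𝔼 b, p b) - p a / Fintype.card α ≤ 𝔼 b, if b ≠ a then p' b else 0 := by
      rw [← expect_single a, ← Finset.expect_sub_distrib]
      refine Finset.expect_le_expect fun b _ => ?_
      by_cases hb : b = a
      · simp [hb]
      · simpa [hb] using hp b
    have h3 : p a * (p a / Fintype.card α) ≤ 1 / Fintype.card α := by
      rw [← mul_div_assoc]
      exact div_le_div_of_nonneg_right (by nlinarith [h0 a, h1 a]) (by positivity)
    nlinarith [mul_le_mul_of_nonneg_left this (h0 a)]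
  calc _ = 𝔼 a, (p a * (𝔼 b, p b) - 1 / Fintype.card α) := by
        rw [Finset.expect_sub_distrib, ← Finset.expect_mul, Fintype.expect_const]; ring
    _ ≤ _ := Finset.expect_le_expect fun a _ => key a

end average

/-! ## Expected values in the simulation -/

section expectation

variable {𝔾 : PrimeGroup} {A : Adversary 𝔾}

/-- The users that were queried to the key oracle, after one more request. -/
def Request.users : Request 𝔾 → List Ident → List Ident
  | .keyQry id, L => id :: L
  | _, L => L

/-- The expected value of `f` at the end of the simulation, where `f` also depends on the list of
the users that were queried to the key oracle; it counts as `0` if the simulation does not stop. -/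
def simExpect (D : 𝔾.Point) (f : List Ident → Outcome A → ℝ) :
    ℕ → List Ident → SimTable A × A.State ⊕ Outcome A → ℝ
  | _, L, .inr o => f L o
  | 0, _, .inl _ => 0
  | n + 1, L, .inl σ => 𝔼 p : Bool × 𝔾.Scalar × 𝔾.Scalar,
      simExpect D f n ((A.ask σ.2).users L) (simStep D σ.1 σ.2 p.1 p.2.1 p.2.2)

/-- The current table. -/
def tableOf : SimTable A × A.State ⊕ Outcome A → SimTable A
  | .inl σ => σ.1
  | .inr o => o.1

/-- The table `t'` contains the table `t`. -/
def SimTable.Sub (t t' : SimTable A) : Prop := ∀ k e, t.find k = some e → t'.find k = some e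

lemma SimTable.find_query_self (tbl : SimTable A) (s : A.State) {k : Ident × 𝔾.Point}
    (r : 𝔾.Scalar) (h : tbl.find k = none) :
    (tbl.query s k r).1.find k = some ((r, s), tbl) := by
  simp [SimTable.query, h, SimTable.find]

lemma SimTable.find_query_ne (tbl : SimTable A) (s : A.State) {k k' : Ident × 𝔾.Point}
    (r : 𝔾.Scalar) (h : k' ≠ k) : (tbl.query s k r).1.find k' = tbl.find k' := by
  unfold SimTable.query
  split <;> simp [SimTable.find, h]

/-- An input is pushed only if it is absent. So a search keeps finding the same entry, with the same
state and the same table below it, and the rewinding point never changes. -/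
lemma SimTable.sub_query (tbl : SimTable A) (s : A.State) (k : Ident × 𝔾.Point)
    (r : 𝔾.Scalar) : tbl.Sub (tbl.query s k r).1 := by
  intro k' e h
  by_cases hk : k' = k
  · subst hk
    simp [SimTable.query, h]
  · rwa [find_query_ne _ _ _ hk]

lemma sub_simStep (D : 𝔾.Point) (tbl : SimTable A) (s : A.State) (c : Bool) (r x : 𝔾.Scalar) :
    tbl.Sub (tableOf (simStep D tbl s c r x)) := by
  unfold simStep
  cases A.ask s with
  | work | coin | scalar => exact fun _ _ h => h
  | _ => exact SimTable.sub_query _ _ _ _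

lemma Request.subset_users (q : Request 𝔾) (L : List Ident) : L ⊆ q.users L := by
  cases q with
  | keyQry id => exact List.subset_cons_self _ _
  | _ => exact List.Subset.refl _

/-- Tables and lists of users only grow, so the comparison is needed only for outcomes that extend
the present ones. -/
lemma simExpect_le {D : 𝔾.Point} {f g : List Ident → Outcome A → ℝ} :
    ∀ {n : ℕ} {L : List Ident} {v : SimTable A × A.State ⊕ Outcome A},
      (∀ L' o, L ⊆ L' → (tableOf v).Sub o.1 → f L' o ≤ g L' o) →
        simExpect D f n L v ≤ simExpect D g n L v
  | n, L, .inr o, h => by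
    rw [simExpect.eq_def, simExpect.eq_def]
    exact h L o (List.Subset.refl _) fun _ _ h => h
  | 0, L, .inl σ, h => le_rfl
  | n + 1, L, .inl σ, h => by
    refine Finset.expect_le_expect fun p _ => simExpect_le fun L' o hL ho => ?_
    exact h L' o (fun _ hi => hL (Request.subset_users _ _ hi)) fun k e hk =>
      ho k e (sub_simStep _ _ _ _ _ _ k e hk)

lemma simExpect_congr {D : 𝔾.Point} {f g : List Ident → Outcome A → ℝ}
    {n : ℕ} {L : List Ident} {v : SimTable A × A.State ⊕ Outcome A}
    (h : ∀ L' o, L ⊆ L' → (tableOf v).Sub o.1 → f L' o = g L' o) :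
    simExpect D f n L v = simExpect D g n L v :=
  le_antisymm (simExpect_le fun L' o h1 h2 => (h L' o h1 h2).le)
    (simExpect_le fun L' o h1 h2 => (h L' o h1 h2).ge)

lemma simExpect_add {D : 𝔾.Point} {f g : List Ident → Outcome A → ℝ} :
    ∀ {n : ℕ} {L : List Ident} {v : SimTable A × A.State ⊕ Outcome A},
      simExpect D (fun L o => f L o + g L o) n L v = simExpect D f n L v + simExpect D g n L v
  | n, L, .inr o => by simp [simExpect.eq_def]
  | 0, L, .inl σ => by simp [simExpect]
  | n + 1, L, .inl σ => by
    simp only [simExpect, ← Finset.expect_add_distrib]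
    exact Finset.expect_congr rfl fun p _ => simExpect_add

lemma simExpect_mul {D : 𝔾.Point} {f : List Ident → Outcome A → ℝ} (a : ℝ) :
    ∀ {n : ℕ} {L : List Ident} {v : SimTable A × A.State ⊕ Outcome A},
      simExpect D (fun L o => f L o * a) n L v = simExpect D f n L v * a
  | n, L, .inr o => by simp [simExpect.eq_def]
  | 0, L, .inl σ => by simp [simExpect]
  | n + 1, L, .inl σ => by
    simp only [simExpect, Finset.expect_mul]
    exact Finset.expect_congr rfl fun p _ => simExpect_mul a

lemma simExpect_nonneg {D : 𝔾.Point} {f : List Ident → Outcome A → ℝ} (hf : ∀ L o, 0 ≤ f L o) :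
    ∀ {n : ℕ} {L : List Ident} {v : SimTable A × A.State ⊕ Outcome A}, 0 ≤ simExpect D f n L v
  | n, L, .inr o => by rw [simExpect.eq_def]; exact hf L o
  | 0, L, .inl σ => le_rfl
  | n + 1, L, .inl σ => Finset.expect_nonneg fun p _ => simExpect_nonneg hf

lemma simExpect_le_one {D : 𝔾.Point} {f : List Ident → Outcome A → ℝ} (hf : ∀ L o, f L o ≤ 1) :
    ∀ {n : ℕ} {L : List Ident} {v : SimTable A × A.State ⊕ Outcome A}, simExpect D f n L v ≤ 1
  | n, L, .inr o => by rw [simExpect.eq_def]; exact hf L o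
  | 0, L, .inl σ => zero_le_one
  | n + 1, L, .inl σ => Finset.expect_le Finset.univ_nonempty fun p _ => simExpect_le_one hf

lemma simExpect_mono {D : 𝔾.Point} {f : List Ident → Outcome A → ℝ} (hf : ∀ L o, 0 ≤ f L o) :
    ∀ {n m : ℕ} {L : List Ident} {v : SimTable A × A.State ⊕ Outcome A}, n ≤ m →
      simExpect D f n L v ≤ simExpect D f m L v
  | n, m, L, .inr o, _ => by rw [simExpect.eq_def, simExpect.eq_def]
  | 0, m, L, .inl σ, _ => simExpect_nonneg hf
  | n + 1, 0, L, .inl σ, h => by omega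
  | n + 1, m + 1, L, .inl σ, h =>
    Finset.expect_le_expect fun p _ => simExpect_mono hf (by omega)

lemma simExpect_users {D : 𝔾.Point} {f : Outcome A → ℝ} :
    ∀ {n : ℕ} {L L' : List Ident} {v : SimTable A × A.State ⊕ Outcome A},
      simExpect D (fun _ o => f o) n L v = simExpect D (fun _ o => f o) n L' v
  | n, L, L', .inr o => by rw [simExpect.eq_def, simExpect.eq_def]
  | 0, L, L', .inl σ => rfl
  | n + 1, L, L', .inl σ => Finset.expect_congr rfl fun p _ => simExpect_users

end expectation

/-! ## Forking -/

section forking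

variable {𝔾 : PrimeGroup} {A : Adversary 𝔾}

/-- The adversary has output a valid key pair. -/
def Forges (D : 𝔾.Point) (o : Outcome A) : Prop :=
  ∃ e, o.1.find o.2.1 = some e ∧ 𝔾.mul o.2.2 𝔾.gen = 𝔾.mul e.1.1 o.2.1.2 + D

/-- The hash value that belongs to the output of the adversary. -/
def hashOf (o : Outcome A) : Option 𝔾.Scalar := (o.1.find o.2.1).map fun e => e.1.1

open Classical in
/-- Indicator of a win with a hash input that satisfies `φ`. -/
def winInd (D : 𝔾.Point) (φ : Ident × 𝔾.Point → Prop) (L : List Ident) (o : Outcome A) : ℝ :=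
  if Forges D o ∧ o.2.1.1 ∉ L ∧ φ o.2.1 then 1 else 0

open Classical in
/-- Indicator of a valid key pair with the hash input `k` and a hash value other than `h`. -/
def otherInd (D : 𝔾.Point) (k : Ident × 𝔾.Point) (h : 𝔾.Scalar) (o : Outcome A) : ℝ :=
  if Forges D o ∧ o.2.1 = k ∧ hashOf o ≠ some h then 1 else 0

/-- The probability that a second run, from the query that belongs to the first output, ends with a
valid key pair for the same hash input and with another hash value. -/
def forkValue (D : 𝔾.Point) (M : ℕ) (o : Outcome A) : ℝ :=
  match o.1.find o.2.1 with
  | none => 0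
  | some e => simExpect D (fun _ => otherInd D o.2.1 e.1.1) M [] (.inl (e.2, e.1.2))

open Classical in
/-- The success of forking for first outputs whose hash input satisfies `φ`. -/
def forkInd (D : 𝔾.Point) (M : ℕ) (φ : Ident × 𝔾.Point → Prop) (o : Outcome A) : ℝ :=
  if Forges D o ∧ φ o.2.1 then forkValue D M o else 0

open Classical in
/-- Indicator of a valid key pair with the hash input `k`. -/
def keyInd (D : 𝔾.Point) (k : Ident × 𝔾.Point) (o : Outcome A) : ℝ :=
  if Forges D o ∧ o.2.1 = k then 1 else 0

/-- The inputs that do not occur in a table. -/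
def SimTable.Fresh (t : SimTable A) (k : Ident × 𝔾.Point) : Prop := t.find k = none

lemma SimTable.Sub.fresh {t t' : SimTable A} (h : t.Sub t') {k : Ident × 𝔾.Point}
    (hk : t'.Fresh k) : t.Fresh k := by
  unfold SimTable.Fresh at *
  by_contra hn
  obtain ⟨e, he⟩ := Option.ne_none_iff_exists'.1 hn
  simp [h k e he] at hk

lemma otherInd_nonneg (D : 𝔾.Point) (k : Ident × 𝔾.Point) (h : 𝔾.Scalar) (o : Outcome A) :
    0 ≤ otherInd D k h o := by unfold otherInd; positivity

lemma forkValue_nonneg (D : 𝔾.Point) (M : ℕ) (o : Outcome A) : 0 ≤ forkValue D M o := by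
  unfold forkValue
  split
  · exact le_rfl
  · exact simExpect_nonneg fun _ o => otherInd_nonneg _ _ _ o

lemma forkInd_nonneg (D : 𝔾.Point) (M : ℕ) (φ : Ident × 𝔾.Point → Prop) (o : Outcome A) :
    0 ≤ forkInd D M φ o := by
  unfold forkInd
  split_ifs
  · exact forkValue_nonneg _ _ _
  · exact le_rfl

lemma forkInd_mono (D : 𝔾.Point) (M : ℕ) {φ ψ : Ident × 𝔾.Point → Prop} (h : ∀ k, φ k → ψ k)
    (o : Outcome A) : forkInd D M φ o ≤ forkInd D M ψ o := by
  unfold forkInd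
  have := forkValue_nonneg D M o
  have := h o.2.1
  split_ifs <;> tauto

lemma winInd_nonneg (D : 𝔾.Point) (φ : Ident × 𝔾.Point → Prop) (L : List Ident) (o : Outcome A) :
    0 ≤ winInd D φ L o := by unfold winInd; positivity

lemma keyInd_nonneg (D : 𝔾.Point) (k : Ident × 𝔾.Point) (o : Outcome A) :
    0 ≤ keyInd D k o := by unfold keyInd; positivity

lemma keyInd_le_one (D : 𝔾.Point) (k : Ident × 𝔾.Point) (o : Outcome A) :
    keyInd D k o ≤ 1 := by unfold keyInd; split_ifs <;> norm_num

/-- In a transition, either each new entry of the table belongs to a user that is queried to the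
key oracle, or exactly the uniform value of one new input is added. -/
lemma simStep_cases (D : 𝔾.Point) (tbl : SimTable A) (s : A.State) :
    (∀ L c r x k, tbl.Fresh k →
      (tableOf (simStep D tbl s c r x)).Fresh k ∨ k.1 ∈ (A.ask s).users L) ∨
    (∃ (k : Ident × 𝔾.Point) (v : 𝔾.Scalar → SimTable A × A.State ⊕ Outcome A),
      tbl.Fresh k ∧ ∀ r, tableOf (v r) = (tbl.query s k r).1 ∧
      ∀ c x, simStep D tbl s c r x = v r) ∧ ∀ L, (A.ask s).users L = L := by
  have hq : ∀ k, ¬ tbl.Fresh k → ∀ r, (tbl.query s k r).1 = tbl := by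
    intro k hk r
    obtain ⟨e, he⟩ := Option.ne_none_iff_exists'.1 hk
    simp [SimTable.query, he]
  unfold simStep
  cases A.ask s with
  | work | coin | scalar => exact .inl fun _ _ _ _ _ h => .inl h
  -- A key query may add an entry, but only for `id`, which it also puts on the list of users; a
  -- winning output is for a user off that list.
  | keyQry id =>
    refine .inl fun L c r x k h => ?_
    by_cases hk : k = (id, 𝔾.mul r⁻¹ (𝔾.mul x 𝔾.gen + -D))
    · subst hk
      exact .inr (by simp [Request.users])
    · exact .inl ((SimTable.find_query_ne _ _ _ hk).trans h)
  | hash id U | keyVer id U y | output id U y =>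
    by_cases hk : tbl.Fresh (id, U)
    · exact .inr ⟨⟨(id, U), _, hk, fun r => ⟨rfl, fun _ _ => rfl⟩⟩, fun _ => rfl⟩
    · refine .inl fun L c r x k h => .inl ?_
      simpa only [tableOf, hq _ hk] using h

/-- Cauchy–Schwarz with weights `1` and `n`: `(p + g)² ≤ (n + 1) * (p² + g² / n)`. The form without
division includes `n = 0`, where `g = 0`. -/
lemma sq_add_le_of_sq_le {n p g v : ℝ} (hn : 0 ≤ n) (hv : 0 ≤ v) (h : g ^ 2 ≤ n * v) :
    (p + g) ^ 2 ≤ (n + 1) * (p ^ 2 + v) := by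
  suffices 2 * p * g ≤ n * p ^ 2 + v by nlinarith
  rcases hn.eq_or_lt with rfl | hn
  · have : g = 0 := by nlinarith
    subst this
    linarith
  · have h1 : n * (2 * p * g) ≤ n * (n * p ^ 2 + v) := by nlinarith [sq_nonneg (n * p - g)]
    exact le_of_mul_le_mul_left h1 hn

variable {D : 𝔾.Point} {tbl : SimTable A} {s : A.State} {k : Ident × 𝔾.Point}

lemma winInd_le_add {r : 𝔾.Scalar} (L : List Ident) (o : Outcome A) :
    winInd D tbl.Fresh L o ≤ keyInd D k o + winInd D (tbl.query s k r).1.Fresh L o := by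
  by_cases hk : o.2.1 = k
  · have : winInd D tbl.Fresh L o ≤ keyInd D k o := by
      unfold winInd keyInd
      split_ifs <;> first | tauto | norm_num
    linarith [winInd_nonneg D (tbl.query s k r).1.Fresh L o]
  · have : winInd D tbl.Fresh L o = winInd D (tbl.query s k r).1.Fresh L o := by
      unfold winInd SimTable.Fresh
      rw [SimTable.find_query_ne _ _ _ hk]
    linarith [keyInd_nonneg D k o]

/-- For an output at `k` the recorded entry is `(r, s)` above `tbl`, so the fork restarts exactly at
`(tbl, s)`, and the second summand vanishes because `k` is no longer fresh. At other inputs the two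
notions of freshness agree. -/
lemma add_le_forkInd {M : ℕ} {r : 𝔾.Scalar} (hk : tbl.Fresh k) {o : Outcome A}
    (ho : (tbl.query s k r).1.Sub o.1) :
    keyInd D k o * simExpect D (fun _ => otherInd D k r) M [] (.inl (tbl, s)) +
      forkInd D M (tbl.query s k r).1.Fresh o ≤ forkInd D M tbl.Fresh o := by
  have hf := ho _ _ (tbl.find_query_self s r hk)
  by_cases hk' : o.2.1 = k
  · by_cases h : Forges D o
    · simp [keyInd, forkInd, h, hk', forkValue, hf, SimTable.Fresh,
        tbl.find_query_self s r hk, show tbl.find k = none from hk]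
    · simp [keyInd, forkInd, h]
  · have e : (tbl.query s k r).1.Fresh o.2.1 = tbl.Fresh o.2.1 := by
      rw [SimTable.Fresh, SimTable.Fresh, SimTable.find_query_ne _ _ _ hk']
    rw [keyInd, forkInd, forkInd, e, if_neg (fun h => hk' h.2), zero_mul, zero_add]

/-- The value `r'` given to `k` survives to the end of the run, so a valid pair at `k` has a hash
value other than `r`. -/
lemma keyInd_le_otherInd {r r' : 𝔾.Scalar} (hr : r' ≠ r) (hk : tbl.Fresh k) {o : Outcome A}
    (ho : (tbl.query s k r').1.Sub o.1) : keyInd D k o ≤ otherInd D k r o := by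
  have hf := ho _ _ (tbl.find_query_self s r' hk)
  by_cases h : Forges D o ∧ o.2.1 = k
  · obtain ⟨h, rfl⟩ := h
    simp [keyInd, otherInd, h, hashOf, hf, hr]
  · rw [keyInd, if_neg h]
    exact otherInd_nonneg _ _ _ _

/-- The forking lemma. -/
lemma sq_simExpect_winInd_le (D : 𝔾.Point) (M : ℕ) :
    ∀ {n : ℕ} {L : List Ident} {v : SimTable A × A.State ⊕ Outcome A}, n ≤ M →
      simExpect D (winInd D (tableOf v).Fresh) n L v ^ 2 ≤
        n * (simExpect D (fun _ => forkInd D M (tableOf v).Fresh) n L v + n / 𝔾.N)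
  | n, L, .inr o, _ => by
    -- The hash input of a valid output lies in its own table, so it is not fresh there.
    have : winInd D (tableOf (.inr o : SimTable A × A.State ⊕ Outcome A)).Fresh L o = 0 := by
      rw [winInd, if_neg]
      rintro ⟨⟨e, he, -⟩, -, h⟩
      simp [SimTable.Fresh, tableOf, he] at h
    rw [simExpect.eq_def, simExpect.eq_def]
    simp only [this]
    have := forkInd_nonneg D M (tableOf (.inr o : SimTable A × A.State ⊕ Outcome A)).Fresh o
    simp only [ne_eq, OfNat.ofNat_ne_zero, not_false_eq_true, zero_pow]
    positivity
  | 0, L, .inl σ, _ => by simp [simExpect]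
  | n + 1, L, .inl (tbl, s), hn => by
    have hN : (0 : ℝ) < 𝔾.N := by exact_mod_cast 𝔾.prime.pos
    have ih := fun (p : Bool × 𝔾.Scalar × 𝔾.Scalar) => sq_simExpect_winInd_le D M (n := n)
      (L := (A.ask s).users L) (v := simStep D tbl s p.1 p.2.1 p.2.2) (by omega)
    have hg : (𝔼 p : Bool × 𝔾.Scalar × 𝔾.Scalar, simExpect D
          (winInd D (tableOf (simStep D tbl s p.1 p.2.1 p.2.2)).Fresh) n ((A.ask s).users L)
          (simStep D tbl s p.1 p.2.1 p.2.2)) ^ 2 ≤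
        n * ((𝔼 p : Bool × 𝔾.Scalar × 𝔾.Scalar, simExpect D
          (fun _ => forkInd D M (tableOf (simStep D tbl s p.1 p.2.1 p.2.2)).Fresh) n
          ((A.ask s).users L) (simStep D tbl s p.1 p.2.1 p.2.2)) + n / 𝔾.N) := by
      refine (sq_expect_le _).trans ((Finset.expect_le_expect fun p _ => ih p).trans_eq ?_)
      rw [← Finset.mul_expect, Finset.expect_add_distrib, Fintype.expect_const]
    have hV : 0 ≤ 𝔼 p : Bool × 𝔾.Scalar × 𝔾.Scalar, simExpect D
          (fun _ => forkInd D M (tableOf (simStep D tbl s p.1 p.2.1 p.2.2)).Fresh) n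
          ((A.ask s).users L) (simStep D tbl s p.1 p.2.1 p.2.2) :=
      Finset.expect_nonneg fun p _ => simExpect_nonneg fun _ o => forkInd_nonneg _ _ _ o
    simp only [simExpect, tableOf]
    push_cast
    rcases simStep_cases D tbl s with h | ⟨⟨k, v, hk, hv⟩, hL⟩
    -- For a user that was never queried, the input is fresh before the transition if and only if it
    -- is fresh after it. The induction hypothesis therefore carries over.
    · have e1 : ∀ p : Bool × 𝔾.Scalar × 𝔾.Scalar,
          simExpect D (winInd D tbl.Fresh) n ((A.ask s).users L)
            (simStep D tbl s p.1 p.2.1 p.2.2) =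
          simExpect D (winInd D (tableOf (simStep D tbl s p.1 p.2.1 p.2.2)).Fresh) n
            ((A.ask s).users L) (simStep D tbl s p.1 p.2.1 p.2.2) := by
        refine fun p => simExpect_congr fun L' o hL' _ => ?_
        have : o.2.1.1 ∉ L' → (tbl.Fresh o.2.1 ↔
            (tableOf (simStep D tbl s p.1 p.2.1 p.2.2)).Fresh o.2.1) := fun ho =>
          ⟨fun hf => (h L _ _ _ _ hf).resolve_right fun hi => ho (hL' hi),
            (sub_simStep _ _ _ _ _ _).fresh⟩
        unfold winInd
        congr 1
        simp only [eq_iff_iff]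
        tauto
      have e2 : (𝔼 p : Bool × 𝔾.Scalar × 𝔾.Scalar, simExpect D
          (fun _ => forkInd D M (tableOf (simStep D tbl s p.1 p.2.1 p.2.2)).Fresh) n
          ((A.ask s).users L) (simStep D tbl s p.1 p.2.1 p.2.2)) ≤
          𝔼 p : Bool × 𝔾.Scalar × 𝔾.Scalar, simExpect D (fun _ => forkInd D M tbl.Fresh) n
            ((A.ask s).users L) (simStep D tbl s p.1 p.2.1 p.2.2) :=
        Finset.expect_le_expect fun p _ => simExpect_le fun L' o _ _ =>
          forkInd_mono D M (fun k hk => (sub_simStep _ _ _ _ _ _).fresh hk) o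
      simp only [e1]
      refine hg.trans ?_
      gcongr <;> linarith
    · have conv : ∀ f : 𝔾.Scalar → ℝ, (𝔼 p : Bool × 𝔾.Scalar × 𝔾.Scalar, f p.2.1) = 𝔼 r, f r :=
        fun f => (expect_snd fun p : 𝔾.Scalar × 𝔾.Scalar => f p.1).trans (expect_fst f)
      simp only [hv, hL] at hg hV ⊢
      rw [conv fun r => simExpect D (winInd D (tbl.query s k r).1.Fresh) n L (v r),
        conv fun r => simExpect D (fun _ => forkInd D M (tbl.query s k r).1.Fresh) n L (v r)] at hg
      rw [conv fun r => simExpect D (fun _ => forkInd D M (tbl.query s k r).1.Fresh) n L (v r)] at hV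
      rw [conv fun r => simExpect D (winInd D tbl.Fresh) n L (v r),
        conv fun r => simExpect D (fun _ => forkInd D M tbl.Fresh) n L (v r)]
      set P : 𝔾.Scalar → ℝ := fun r => simExpect D (fun _ => keyInd D k) n L (v r) with hP
      set γ : 𝔾.Scalar → ℝ := fun r =>
        simExpect D (fun _ => otherInd D k r) M [] (.inl (tbl, s)) with hγ
      have hP0 : ∀ r, 0 ≤ P r := fun r => simExpect_nonneg fun _ o => keyInd_nonneg D k o
      have hP1 : ∀ r, P r ≤ 1 := fun r => simExpect_le_one fun _ o => keyInd_le_one D k o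
      -- The second run draws a new value `b` for `k`, and for `b ≠ r` it continues like a first run
      -- with this value. Repeating the transition uses one of its `M` steps, and `n + 1 ≤ M` leaves
      -- at least `n`.
      have hPγ : ∀ r, (𝔼 b, if b ≠ r then P b else 0) ≤ γ r := by
        intro r
        obtain ⟨M', rfl⟩ : ∃ M', M = M' + 1 := ⟨M - 1, by omega⟩
        simp only [hγ, simExpect, hL, hv]
        rw [conv fun b => simExpect D (fun _ => otherInd D k r) M' [] (v b)]
        refine Finset.expect_le_expect fun b _ => ?_
        split_ifs with hb
        · refine (simExpect_mono (fun _ o => keyInd_nonneg D k o)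
            (show n ≤ M' by omega)).trans ?_
          rw [simExpect_users (L' := [])]
          refine simExpect_le fun L' o _ ho => keyInd_le_otherInd (s := s) hb hk ?_
          rwa [(hv b).1] at ho
        · exact simExpect_nonneg fun _ o => otherInd_nonneg _ _ _ o
      have hX : (𝔼 r, simExpect D (winInd D tbl.Fresh) n L (v r)) ≤
          (𝔼 r, P r) + 𝔼 r, simExpect D (winInd D (tbl.query s k r).1.Fresh) n L (v r) := by
        rw [← Finset.expect_add_distrib]
        refine Finset.expect_le_expect fun r _ => ?_
        rw [hP, ← simExpect_add]
        exact simExpect_le fun L' o _ _ => winInd_le_add L' o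
      have hX0 : 0 ≤ 𝔼 r, simExpect D (winInd D tbl.Fresh) n L (v r) :=
        Finset.expect_nonneg fun r _ => simExpect_nonneg fun L o => winInd_nonneg _ _ _ o
      have hY : (𝔼 r, P r * γ r) +
          (𝔼 r, simExpect D (fun _ => forkInd D M (tbl.query s k r).1.Fresh) n L (v r)) ≤
          𝔼 r, simExpect D (fun _ => forkInd D M tbl.Fresh) n L (v r) := by
        rw [← Finset.expect_add_distrib]
        refine Finset.expect_le_expect fun r _ => ?_
        rw [hP, ← simExpect_mul, ← simExpect_add]
        refine simExpect_le fun L' o _ ho => ?_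
        rw [(hv r).1] at ho
        exact add_le_forkInd hk ho
      have hQ : (𝔼 r, P r) ^ 2 - 1 / 𝔾.N ≤ 𝔼 r, P r * γ r := by
        have := sq_expect_sub_le hP0 hP1 fun _ => le_rfl
        rw [ZMod.card] at this
        exact this.trans (Finset.expect_le_expect fun r _ =>
          mul_le_mul_of_nonneg_left (hPγ r) (hP0 r))
      -- Cauchy–Schwarz separates forgeries at `k` from later ones. The `1 / N` lost in `hQ` through
      -- equal hash values turns `n / N` into `(n + 1) / N`.
      refine (pow_le_pow_left₀ hX0 hX 2).trans
        ((sq_add_le_of_sq_le (Nat.cast_nonneg n) (by positivity) hg).trans ?_)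
      rw [add_div]
      refine mul_le_mul_of_nonneg_left ?_ (by positivity)
      linarith

end forking

/-! ## The experiment and the simulation -/

section comparison

lemma toReal_uniform_bind {α β : Type} [Fintype α] [Nonempty α] (k : α → PMF β) (b : β) :
    ((PMF.uniformOfFintype α).bind k b).toReal = 𝔼 a, (k a b).toReal := by
  rw [PMF.bind_apply, tsum_fintype, ENNReal.toReal_sum
    (fun a _ => ENNReal.mul_ne_top (PMF.apply_ne_top _ _) (PMF.apply_ne_top _ _)),
    Fintype.expect_eq_sum_div_card, Finset.sum_div]
  refine Finset.sum_congr rfl fun a _ => ?_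
  rw [PMF.uniformOfFintype_apply, ENNReal.toReal_mul, ENNReal.toReal_inv, ENNReal.toReal_natCast,
    div_eq_inv_mul]

lemma toReal_pmf_le_one {α : Type} (p : PMF α) (a : α) : (p a).toReal ≤ 1 :=
  ENNReal.toReal_le_of_le_ofReal zero_le_one (by simpa using p.coe_le_one a)

variable {𝔾 : PrimeGroup} {A : Adversary 𝔾}

/-- The probability that a computation with the random oracle answers `true`. -/
def ROM.prob (X : ROM 𝔾 Bool) (T : Table 𝔾) : ℝ := ((Prod.fst <$> X.run T) true).toReal

lemma ROM.prob_nonneg (X : ROM 𝔾 Bool) (T : Table 𝔾) : 0 ≤ ROM.prob X T := ENNReal.toReal_nonneg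

lemma ROM.prob_le_one (X : ROM 𝔾 Bool) (T : Table 𝔾) : ROM.prob X T ≤ 1 := toReal_pmf_le_one _ _

lemma ROM.prob_pure (b : Bool) (T : Table 𝔾) :
    ROM.prob (pure b) T = if b = true then 1 else 0 := by
  have : Prod.fst <$> (pure b : ROM 𝔾 Bool).run T = PMF.pure b := PMF.pure_map _ _
  rw [ROM.prob, this, PMF.pure_apply]
  cases b <;> simp

lemma ROM.prob_uniform {α : Type} [Fintype α] [Nonempty α] (k : α → ROM 𝔾 Bool) (T : Table 𝔾) :
    ROM.prob (uniform α >>= k) T = 𝔼 a, ROM.prob (k a) T := by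
  have : Prod.fst <$> (uniform α >>= k).run T =
      (PMF.uniformOfFintype α).bind fun a => Prod.fst <$> (k a).run T := by
    change PMF.map _ (PMF.bind (PMF.bind _ fun a => PMF.pure (a, T)) _) = _
    rw [PMF.bind_bind, PMF.map_bind]
    simp only [PMF.pure_bind]
    rfl
  rw [ROM.prob, this, toReal_uniform_bind]
  rfl

lemma ROM.prob_hashQuery_none {id : Ident} {U : 𝔾.Point} (k : 𝔾.Scalar → ROM 𝔾 Bool)
    {T : Table 𝔾} (h : T (id, U) = none) :
    ROM.prob (hashQuery id U >>= k) T =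
      𝔼 r, ROM.prob (k r) (open Classical in Function.update T (id, U) (some r)) := by
  classical
  have : Prod.fst <$> (hashQuery id U >>= k).run T =
      (PMF.uniformOfFintype 𝔾.Scalar).bind fun r =>
        Prod.fst <$> (k r).run (open Classical in Function.update T (id, U) (some r)) := by
    have e : (hashQuery id U).run T = PMF.bind (PMF.uniformOfFintype 𝔾.Scalar) fun r =>
        PMF.pure (r, open Classical in Function.update T (id, U) (some r)) := by
      simp only [hashQuery, StateT.run_mk, h]
      rfl
    rw [StateT.run_bind, e]
    change PMF.map _ (PMF.bind (PMF.bind _ _) _) = _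
    rw [PMF.bind_bind, PMF.map_bind]
    simp only [PMF.pure_bind]
    rfl
  rw [ROM.prob, this, toReal_uniform_bind]
  rfl

lemma ROM.prob_hashQuery_some {id : Ident} {U : 𝔾.Point} (k : 𝔾.Scalar → ROM 𝔾 Bool)
    {T : Table 𝔾} {r : 𝔾.Scalar} (h : T (id, U) = some r) :
    ROM.prob (hashQuery id U >>= k) T = ROM.prob (k r) T := by
  have e : (hashQuery id U).run T = PMF.pure (r, T) := by
    simp only [hashQuery, StateT.run_mk, h]
    rfl
  rw [ROM.prob, ROM.prob, StateT.run_bind, e]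
  change (PMF.map _ (PMF.bind (PMF.pure _) _) true).toReal = _
  rw [PMF.pure_bind]
  rfl

/-- The values in a table of the simulation. -/
def SimTable.values (tbl : SimTable A) : Table 𝔾 := fun k => (tbl.find k).map fun e => e.1.1

/-- A hash query in the experiment and in the simulation. -/
lemma ROM.prob_hashQuery (tbl : SimTable A) (s : A.State) (id : Ident) (U : 𝔾.Point)
    (k : 𝔾.Scalar → ROM 𝔾 Bool) :
    ROM.prob (hashQuery id U >>= k) tbl.values = 𝔼 r,
      ROM.prob (k (tbl.query s (id, U) r).2) (tbl.query s (id, U) r).1.values := by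
  cases h : tbl.find (id, U) with
  | none =>
    rw [ROM.prob_hashQuery_none k (by simp [SimTable.values, h])]
    refine Finset.expect_congr rfl fun r _ => ?_
    simp only [SimTable.query, h]
    congr 1
    funext k'
    classical
    rw [Function.update_apply]
    by_cases hk : k' = (id, U) <;> simp [SimTable.values, SimTable.find, hk]
  | some e =>
    rw [ROM.prob_hashQuery_some k (r := e.1.1) (by simp [SimTable.values, h])]
    simp [SimTable.query, h]

/-- The sum over the units is at most `N - 1`, so dividing it by `N - 1` instead of `N` adds at most
`1 / N`. -/
lemma expect_units_le {f : 𝔾.Scalar → ℝ} (h0 : ∀ a, 0 ≤ f a) (h1 : ∀ a, f a ≤ 1) :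
    (𝔼 b : (𝔾.Scalar)ˣ, f b) ≤ (𝔼 a, f a) + 1 / 𝔾.N := by
  have hN : (2 : ℝ) ≤ 𝔾.N := by exact_mod_cast 𝔾.prime.two_le
  have hc : (Fintype.card (𝔾.Scalar)ˣ : ℝ) = 𝔾.N - 1 := by
    rw [ZMod.card_units_eq_totient, Nat.totient_prime 𝔾.prime, Nat.cast_sub 𝔾.prime.one_le]
    simp
  have hu0 : 0 ≤ ∑ b : (𝔾.Scalar)ˣ, f b := Finset.sum_nonneg fun b _ => h0 b
  have hu1 : ∑ b : (𝔾.Scalar)ˣ, f b ≤ 𝔾.N - 1 := by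
    rw [← hc]
    simpa using Finset.sum_le_card_nsmul Finset.univ (fun b : (𝔾.Scalar)ˣ => f b) 1
      fun b _ => h1 b
  have hle : ∑ b : (𝔾.Scalar)ˣ, f b ≤ ∑ a, f a := by
    rw [← Finset.sum_image (f := f) (g := fun b : (𝔾.Scalar)ˣ => (b : 𝔾.Scalar))
      (fun a _ b _ h => Units.ext h)]
    exact Finset.sum_le_sum_of_subset_of_nonneg (Finset.subset_univ _) fun a _ _ => h0 a
  rw [Fintype.expect_eq_sum_div_card, Fintype.expect_eq_sum_div_card, hc, ZMod.card, ← add_div,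
    div_le_div_iff₀ (by linarith) (by linarith)]
  nlinarith

-- Since `b ↦ b × G` is injective, each entry of the table excludes at most one `b`.
open Classical in
lemma expect_notFresh_le (tbl : SimTable A) (id : Ident) :
    (𝔼 b : 𝔾.Scalar, if tbl.Fresh (id, b • 𝔾.gen) then (0 : ℝ) else 1) ≤
      tbl.length / 𝔾.N := by
  induction tbl with
  | nil => simp [SimTable.Fresh, SimTable.find]
  | cons e tbl ih =>
    obtain ⟨u, hu⟩ := smul_gen_bijective.2 e.1.2
    have : ∀ b : 𝔾.Scalar, (if SimTable.Fresh (A := A) (e :: tbl) (id, b • 𝔾.gen) then (0 : ℝ) else 1) ≤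
        (if SimTable.Fresh (A := A) tbl (id, b • 𝔾.gen) then (0 : ℝ) else 1) + if b = u then 1 else 0 := by
      intro b
      by_cases hb : b = u
      · rw [if_pos hb]
        split_ifs <;> norm_num
      · have hne : (id, b • 𝔾.gen) ≠ e.1 := fun h =>
          hb (smul_gen_inj.1 ((congrArg Prod.snd h).trans hu.symm))
        rw [if_neg hb, add_zero]
        refine le_of_eq (if_congr ?_ rfl rfl)
        rw [SimTable.Fresh, SimTable.Fresh, SimTable.find, if_neg hne]
    refine (Finset.expect_le_expect fun b _ => this b).trans ?_
    rw [Finset.expect_add_distrib, expect_single, ZMod.card, List.length_cons, Nat.cast_add,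
      add_div, Nat.cast_one]
    linarith

/-- For fixed `r ≠ 0` a uniform `b` makes `r * b + d` uniform: real keys look like the `x` that the
simulation draws. -/
lemma expect_zero_ite_le {S : 𝔾.Scalar → 𝔾.Scalar → ℝ} (hS : ∀ r x, 0 ≤ S r x) (d : 𝔾.Scalar) :
    (𝔼 b, 𝔼 r, if r = 0 then 0 else S r (r * b + d)) ≤ 𝔼 r, 𝔼 x, S r x := by
  rw [Finset.expect_comm]
  refine Finset.expect_le_expect fun r _ => ?_
  by_cases hr : r = 0
  · simp only [hr, if_true, Finset.expect_const_zero]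
    exact Finset.expect_nonneg fun x _ => hS 0 x
  · simp only [hr, if_false]
    refine le_of_eq (Fintype.expect_bijective (fun b => r * b + d) ?_ _ _ fun b => rfl)
    refine Finite.injective_iff_bijective.1 fun a b h => ?_
    exact mul_left_cancel₀ hr (add_right_cancel h)

-- If the input is new and `r ≠ 0`, then `b × G = r⁻¹ × (x × G - D)` for `x = r * b + d`, which is
-- the simulated answer. In the other cases the probability is bounded by `1`.
open Classical in
lemma prob_hashQuery_le {d b : 𝔾.Scalar} {tbl : SimTable A} {s : A.State} {id : Ident}
    {K : 𝔾.Point × 𝔾.Scalar → ROM 𝔾 Bool} {S : 𝔾.Scalar → 𝔾.Scalar → ℝ} {ε : ℝ} (hε : 0 ≤ ε)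
    (hS : ∀ r x, 0 ≤ S r x)
    (hK : ∀ r x U, U = 𝔾.mul r⁻¹ (𝔾.mul x 𝔾.gen + -𝔾.mul d 𝔾.gen) →
      ROM.prob (K (U, x)) (tbl.query s (id, U) r).1.values ≤ S r x + ε) :
    ROM.prob (hashQuery id (b • 𝔾.gen) >>= fun h => K (b • 𝔾.gen, h * b + d)) tbl.values ≤
      (if tbl.Fresh (id, b • 𝔾.gen) then (0 : ℝ) else 1) +
        𝔼 r, (((if r = 0 then 1 else 0) + if r = 0 then 0 else S r (r * b + d)) + ε) := by
  have h0 : ∀ r, 0 ≤ (((if r = 0 then (1 : ℝ) else 0) +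
      if r = 0 then 0 else S r (r * b + d)) + ε) := by
    intro r
    have := hS r (r * b + d)
    split_ifs <;> linarith
  split_ifs with hfr
  · rw [zero_add, ROM.prob_hashQuery tbl s]
    refine Finset.expect_le_expect fun r _ => ?_
    split_ifs with hr
    · have := ROM.prob_le_one (K (b • 𝔾.gen, (tbl.query s (id, b • 𝔾.gen) r).2 * b + d))
        (tbl.query s (id, b • 𝔾.gen) r).1.values
      linarith
    · have h2 : (tbl.query s (id, b • 𝔾.gen) r).2 = r := by
        simp [SimTable.query, show tbl.find (id, b • 𝔾.gen) = none from hfr]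
      rw [h2, zero_add]
      refine hK r (r * b + d) _ ?_
      simp only [mul_eq_smul, ← sub_eq_add_neg, ← sub_smul, add_sub_cancel_right, smul_smul,
        inv_mul_cancel_left₀ hr]
  · have h1 := ROM.prob_le_one (hashQuery id (b • 𝔾.gen) >>= fun h =>
      K (b • 𝔾.gen, h * b + d)) tbl.values
    have h2 := Finset.expect_nonneg fun r (_ : r ∈ Finset.univ) => h0 r
    linarith

/-- A key query in the experiment and in the simulation. -/
lemma prob_keyQry_le {d : 𝔾.Scalar} {tbl : SimTable A} {s : A.State} {id : Ident}
    {K : 𝔾.Point × 𝔾.Scalar → ROM 𝔾 Bool} {S : 𝔾.Scalar → 𝔾.Scalar → ℝ} {ε : ℝ} (hε : 0 ≤ ε)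
    (hS : ∀ r x, 0 ≤ S r x)
    (hK : ∀ r x U, U = 𝔾.mul r⁻¹ (𝔾.mul x 𝔾.gen + -𝔾.mul d 𝔾.gen) →
      ROM.prob (K (U, x)) (tbl.query s (id, U) r).1.values ≤ S r x + ε) :
    ROM.prob (AQ.kg 𝔾 d id >>= K) tbl.values ≤
      (𝔼 r, 𝔼 x, S r x) + ε + (tbl.length + 2) / 𝔾.N := by
  obtain ⟨f, hf⟩ : ∃ f : 𝔾.Scalar → ℝ, ∀ b, f b = ROM.prob (hashQuery id (b • 𝔾.gen) >>= fun h =>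
    K (b • 𝔾.gen, h * b + d)) tbl.values := ⟨_, fun _ => rfl⟩
  have e : ROM.prob (AQ.kg 𝔾 d id >>= K) tbl.values = 𝔼 b : (𝔾.Scalar)ˣ, f b := by
    simp only [AQ.kg, bind_assoc, pure_bind, ROM.prob_uniform, hf, mul_eq_smul]
  have hu : (𝔼 b : (𝔾.Scalar)ˣ, f b) ≤ (𝔼 b, f b) + 1 / 𝔾.N := by
    refine expect_units_le (fun b => ?_) fun b => ?_
    · rw [hf]
      exact ROM.prob_nonneg _ _
    · rw [hf]
      exact ROM.prob_le_one _ _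
  have h1 : (𝔼 r : 𝔾.Scalar, if r = 0 then (1 : ℝ) else 0) = 1 / 𝔾.N := by
    rw [expect_single, ZMod.card]
  have htot : (𝔼 b, f b) ≤ tbl.length / 𝔾.N + (1 / 𝔾.N + (𝔼 r, 𝔼 x, S r x) + ε) := by
    refine (Finset.expect_le_expect fun b _ =>
      (hf b).trans_le (prob_hashQuery_le hε hS hK)).trans ?_
    simp only [Finset.expect_add_distrib, h1, Fintype.expect_const]
    have := expect_notFresh_le tbl id
    have := expect_zero_ite_le hS d
    linarith
  -- The three losses: a point that is already in the table, `r = 0`, and `b` drawn from the units.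
  have h2 : ((tbl.length : ℝ) + 2) / 𝔾.N = tbl.length / 𝔾.N + (1 / 𝔾.N + 1 / 𝔾.N) := by ring
  rw [e, h2]
  linarith

lemma SimTable.length_query_le (tbl : SimTable A) (s : A.State) (k : Ident × 𝔾.Point)
    (r : 𝔾.Scalar) : (tbl.query s k r).1.length ≤ tbl.length + 1 := by
  unfold SimTable.query
  split <;> simp

lemma SimTable.exists_find_query (tbl : SimTable A) (s : A.State) (k : Ident × 𝔾.Point)
    (r : 𝔾.Scalar) :
    ∃ e, (tbl.query s k r).1.find k = some e ∧ e.1.1 = (tbl.query s k r).2 := by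
  cases h : tbl.find k with
  | none => exact ⟨_, tbl.find_query_self s r h, by simp [SimTable.query, h]⟩
  | some e => exact ⟨e, by simp [SimTable.query, h], by simp [SimTable.query, h]⟩

lemma expect_coins (f : Bool → ℝ) :
    (𝔼 p : Bool × 𝔾.Scalar × 𝔾.Scalar, f p.1) = 𝔼 c, f c := expect_fst f

lemma expect_coins_scalar (f : 𝔾.Scalar → ℝ) :
    (𝔼 p : Bool × 𝔾.Scalar × 𝔾.Scalar, f p.2.1) = 𝔼 r, f r :=
  (expect_snd fun p : 𝔾.Scalar × 𝔾.Scalar => f p.1).trans (expect_fst f)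

lemma expect_coins_scalars (f : 𝔾.Scalar → 𝔾.Scalar → ℝ) :
    (𝔼 p : Bool × 𝔾.Scalar × 𝔾.Scalar, f p.2.1 p.2.2) = 𝔼 r, 𝔼 x, f r x := by
  rw [expect_snd fun p : 𝔾.Scalar × 𝔾.Scalar => f p.1 p.2, ← Finset.univ_product_univ,
    Finset.expect_product]

open Classical in
/-- The adversary wins the experiment hardly more often than the simulation. -/
lemma prob_play_le {B m : ℕ} {d : 𝔾.Scalar} :
    ∀ {j n : ℕ} {L : List Ident} {tbl : SimTable A} {s : A.State}, A.Bounded B j s →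
      tbl.length + j ≤ m →
      ROM.prob (A.play d n L s) tbl.values ≤
        simExpect (𝔾.mul d 𝔾.gen) (winInd (𝔾.mul d 𝔾.gen) fun _ => True) j L (.inl (tbl, s)) +
          j * ((m + 2) / 𝔾.N)
  | 0, _, _, _, _, hs, _ => hs.elim
  | j + 1, 0, L, tbl, s, _, _ => by
    rw [Adversary.play, ROM.prob_pure, if_neg (by simp)]
    have := @simExpect_nonneg _ _ (𝔾.mul d 𝔾.gen) _
      (winInd_nonneg (A := A) (𝔾.mul d 𝔾.gen) fun _ => True) (j + 1) L (.inl (tbl, s))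
    positivity
  | j + 1, n + 1, L, tbl, s, hs, hm => by
    -- One loss for every transition, whatever its kind: `tbl.length + j ≤ m` bounds all tables to
    -- come. Only key queries need it.
    have hδ : 0 ≤ ((m : ℝ) + 2) / 𝔾.N := by positivity
    have hj : ((j + 1 : ℕ) : ℝ) * (((m : ℝ) + 2) / 𝔾.N) =
        j * (((m : ℝ) + 2) / 𝔾.N) + (m + 2) / 𝔾.N := by push_cast; ring
    have havg : ∀ {α : Type} [Fintype α] [Nonempty α] (f g : α → ℝ),
        (∀ a, f a ≤ g a + j * (((m : ℝ) + 2) / 𝔾.N)) →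
          (𝔼 a, f a) ≤ (𝔼 a, g a) + (j + 1 : ℕ) * (((m : ℝ) + 2) / 𝔾.N) := by
      intro α _ _ f g h
      refine (Finset.expect_le_expect fun a _ => h a).trans ?_
      rw [Finset.expect_add_distrib, Fintype.expect_const, hj]
      linarith
    have hlen := fun k r => tbl.length_query_le s k r
    have hs := hs.2
    revert hs
    simp only [Adversary.play, simExpect, simStep]
    cases h : A.ask s with
    | work =>
      intro hs
      simp only [Request.users, Fintype.expect_const, hj]
      have := prob_play_le (n := n) (d := d) (L := L) hs (tbl := tbl) (m := m) (by omega)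
      linarith
    | coin =>
      intro hs
      simp only [Request.users, ROM.prob_uniform]
      rw [expect_coins fun c => simExpect _ _ j L (.inl (tbl, A.tell s (.bit c)))]
      exact havg _ _ fun c => prob_play_le (hs c) (by omega)
    | scalar =>
      intro hs
      simp only [Request.users, ROM.prob_uniform]
      rw [expect_coins_scalar fun r => simExpect _ _ j L (.inl (tbl, A.tell s (.scalar r)))]
      exact havg _ _ fun r => prob_play_le (hs r) (by omega)
    | hash id U =>
      intro hs
      simp only [Request.users, ROM.prob_hashQuery tbl s]
      rw [expect_coins_scalar fun r => simExpect _ _ j L (.inl ((tbl.query s (id, U) r).1,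
        A.tell s (.scalar (tbl.query s (id, U) r).2)))]
      exact havg _ _ fun r => prob_play_le (hs _) (by have := hlen (id, U) r; omega)
    | keyQry id =>
      intro hs
      simp only [Request.users]
      rw [expect_coins_scalars fun r x => simExpect _ _ j (id :: L) (.inl
        ((tbl.query s (id, 𝔾.mul r⁻¹ (𝔾.mul x 𝔾.gen + -𝔾.mul d 𝔾.gen)) r).1,
        A.tell s (.key (𝔾.mul r⁻¹ (𝔾.mul x 𝔾.gen + -𝔾.mul d 𝔾.gen)) x)))]
      refine (prob_keyQry_le (s := s) (S := fun r x => simExpect (𝔾.mul d 𝔾.gen)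
        (winInd (𝔾.mul d 𝔾.gen) fun _ => True) j (id :: L) (.inl
        ((tbl.query s (id, 𝔾.mul r⁻¹ (𝔾.mul x 𝔾.gen + -𝔾.mul d 𝔾.gen)) r).1,
        A.tell s (.key (𝔾.mul r⁻¹ (𝔾.mul x 𝔾.gen + -𝔾.mul d 𝔾.gen)) x)))) (ε := j * (((m : ℝ) + 2) / 𝔾.N)) (by positivity)
        (fun r x => simExpect_nonneg (winInd_nonneg _ _)) fun r x U hU => ?_).trans ?_
      · subst hU
        exact prob_play_le (hs _ _)
          ((Nat.add_le_add_right (hlen _ _) _).trans (by omega))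
      · rw [hj, add_assoc]
        gcongr
        omega
    | keyVer id U y =>
      intro hs
      simp only [Request.users, AQ.keyVer, bind_assoc, pure_bind, ROM.prob_hashQuery tbl s]
      rw [expect_coins_scalar fun r => simExpect _ _ j L (.inl ((tbl.query s (id, U) r).1,
        A.tell s (.bit (decide (𝔾.mul y 𝔾.gen =
          𝔾.mul (tbl.query s (id, U) r).2 U + 𝔾.mul d 𝔾.gen)))))]
      exact havg _ _ fun r => prob_play_le (hs _) (by have := hlen (id, U) r; omega)
    | output id U y =>
      intro _
      simp only [Request.users, AQ.keyVer, bind_assoc, pure_bind, ROM.prob_hashQuery tbl s]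
      rw [expect_coins_scalar fun r => simExpect _ _ j L (.inr ((tbl.query s (id, U) r).1,
        ((id, U), y)))]
      refine havg _ _ fun r => ?_
      rw [ROM.prob_pure, simExpect.eq_def]
      have hnn : 0 ≤ (j : ℝ) * ((m + 2) / 𝔾.N) := by positivity
      split_ifs with hw
      · rw [Bool.and_eq_true, decide_eq_true_eq, decide_eq_true_eq] at hw
        obtain ⟨e, he, hv⟩ := tbl.exists_find_query s (id, U) r
        simp only [winInd]
        rw [if_pos ⟨⟨e, he, by rw [hv]; exact hw.1⟩, hw.2, trivial⟩]
        linarith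
      · exact add_nonneg (winInd_nonneg _ _ _ _) hnn

end comparison

/-! ## The success of the reduction -/

section success

variable {𝔾 : PrimeGroup} {A : Adversary 𝔾}

lemma toReal_withCoins {β : Type} (k : Bool → 𝔾.Scalar → 𝔾.Scalar → PMF β) (b : β) :
    (withCoins k b).toReal =
      𝔼 p : Bool × 𝔾.Scalar × 𝔾.Scalar, (k p.1 p.2.1 p.2.2 b).toReal := by
  simp only [withCoins, toReal_uniform_bind]
  simp only [← Finset.univ_product_univ, Finset.expect_product]

lemma withCoins_bind {α β : Type} (k : Bool → 𝔾.Scalar → 𝔾.Scalar → PMF α) (f : α → PMF β) :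
    (withCoins k).bind f = withCoins fun c r x => (k c r x).bind f := by
  simp only [withCoins, PMF.bind_bind]

/-- Passes from expectations to probabilities; it is applied to the first run and, within it, to the
second. Runs that do not stop count as `0`, hence only an inequality. -/
lemma simExpect_le_bind {D : 𝔾.Point} {β : Type} {k : Option (Outcome A) → PMF β} {b : β}
    {f : Outcome A → ℝ} (hf : ∀ o, f o ≤ (k (some o) b).toReal) :
    ∀ {n : ℕ} {L : List Ident} {v : SimTable A × A.State ⊕ Outcome A},
      simExpect D (fun _ => f) n L v ≤ ((simulation D n v).bind k b).toReal
  | n, L, .inr o => by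
    rw [simExpect.eq_def, simulation.eq_def]
    simpa using hf o
  | 0, L, .inl σ => ENNReal.toReal_nonneg
  | n + 1, L, .inl σ => by
    rw [simExpect, simulation, withCoins_bind, toReal_withCoins]
    exact Finset.expect_le_expect fun p _ => simExpect_le_bind hf

lemma otherInd_le_pure {d : 𝔾.Scalar} {Y : 𝔾.Point} {k : Ident × 𝔾.Point} {x h : 𝔾.Scalar}
    (hx : 𝔾.mul x 𝔾.gen = 𝔾.mul h k.2 + 𝔾.mul d 𝔾.gen) (o : Outcome A) :
    otherInd (𝔾.mul d 𝔾.gen) k h o ≤ (PMF.pure ((some o).map fun o =>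
      match SimTable.find k o.1 with
      | none => 𝔾.gen
      | some e => 𝔾.mul (Prog.dlog x h o.2.2 e.1.1) Y) (some (𝔾.mul d Y))).toReal := by
  unfold otherInd
  split_ifs with ho
  · obtain ⟨⟨e, he, hv⟩, rfl, hh⟩ := ho
    have hne : e.1.1 ≠ h := by simpa [hashOf, he] using hh
    simp [he, dlog_eq hx hv hne]
  · exact ENNReal.toReal_nonneg

lemma simExpect_forkInd_le {d : 𝔾.Scalar} (F : ℕ) (φ : Ident × 𝔾.Point → Prop) (Y : 𝔾.Point) :
    simExpect (𝔾.mul d 𝔾.gen) (fun _ => forkInd (𝔾.mul d 𝔾.gen) F φ) F []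
        (.inl (([] : SimTable A), A.init (𝔾.mul d 𝔾.gen))) ≤
      (Prog.forkPMF A F (𝔾.mul d 𝔾.gen) Y (some (𝔾.mul d Y))).toReal := by
  refine simExpect_le_bind fun o => ?_
  unfold forkInd
  split_ifs with ho
  · obtain ⟨⟨e, he, hv⟩, -⟩ := ho
    simp only [forkValue, he]
    exact simExpect_le_bind fun o' => otherInd_le_pure hv o'
  · exact ENNReal.toReal_nonneg

lemma le_toReal_cdhPMF {a b : 𝔾.Scalar} (F : ℕ) (φ : Ident × 𝔾.Point → Prop) :
    (1 / 𝔾.N + simExpect (𝔾.mul a 𝔾.gen) (fun _ => forkInd (𝔾.mul a 𝔾.gen) F φ) F []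
        (.inl (([] : SimTable A), A.init (𝔾.mul a 𝔾.gen)))) / 2 ≤
      (Prog.cdhPMF A F (𝔾.mul a 𝔾.gen) (𝔾.mul b 𝔾.gen)
        (some (𝔾.mul (a * b) 𝔾.gen))).toReal := by
  have h1 := simExpect_forkInd_le (A := A) (d := a) F φ (𝔾.mul b 𝔾.gen)
  have h2 : (((PMF.uniformOfFintype 𝔾.Scalar).bind fun r =>
      PMF.pure (some (𝔾.mul r 𝔾.gen))) (some (𝔾.mul (a * b) 𝔾.gen))).toReal = 1 / 𝔾.N := by
    have hsingle := expect_single (a * b) (1 : ℝ)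
    rw [ZMod.card] at hsingle
    rw [toReal_uniform_bind, ← hsingle]
    refine Finset.expect_congr rfl fun r _ => ?_
    by_cases hr : r = a * b
    · simp [hr]
    · have : ¬ a * b = r := fun h => hr h.symm
      simp [hr, this, mul_eq_smul, smul_gen_inj]
  rw [show 𝔾.mul a (𝔾.mul b 𝔾.gen) = 𝔾.mul (a * b) 𝔾.gen by
    simp only [mul_eq_smul, smul_smul]] at h1
  rw [Prog.cdhPMF, toReal_uniform_bind, Fintype.expect_eq_sum_div_card]
  simp only [Fintype.sum_bool, Fintype.card_bool, h2]
  push_cast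
  linarith

lemma bind_pure_decide {α : Type} (p : PMF α) (c : α) [DecidablePred fun r => r = c] :
    (p.bind fun r => PMF.pure (decide (r = c))) true = p c := by
  rw [PMF.bind_apply, tsum_eq_single c]
  · simp
  · intro r hr
    simp [hr]

open Classical in
lemma le_toReal_dhSuccess {B F t : ℕ} (hF : 2 * B < F) (ht : Prog.cdh.cost F ≤ t)
    (hs : ∀ D, A.Bounded B B (A.init D)) (φ : Ident × 𝔾.Point → Prop) :
    (1 / 𝔾.N + 𝔼 a : 𝔾.Scalar, simExpect (𝔾.mul a 𝔾.gen)
        (fun _ => forkInd (𝔾.mul a 𝔾.gen) F φ) F []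
        (.inl (([] : SimTable A), A.init (𝔾.mul a 𝔾.gen)))) / 2 ≤
      (dhSuccess A Prog.cdh t).toReal := by
  have e : (dhSuccess A Prog.cdh t).toReal = 𝔼 a : 𝔾.Scalar, 𝔼 b : 𝔾.Scalar,
      (Prog.cdhPMF A F (𝔾.mul a 𝔾.gen) (𝔾.mul b 𝔾.gen)
        (some (𝔾.mul (a * b) 𝔾.gen))).toReal := by
    change ENNReal.toReal (((PMF.uniformOfFintype 𝔾.Scalar).bind fun a =>
      (PMF.uniformOfFintype 𝔾.Scalar).bind fun b =>
      (Prog.cdh.runWithin A t (𝔾.mul a 𝔾.gen, 𝔾.mul b 𝔾.gen)).bind fun r =>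
      PMF.pure (decide (r = some (𝔾.mul (a * b) 𝔾.gen))) : PMF Bool) true) = _
    simp only [toReal_uniform_bind, bind_pure_decide]
    refine Finset.expect_congr rfl fun a _ => Finset.expect_congr rfl fun b _ => ?_
    obtain ⟨h1, h2⟩ := Prog.sem_cdh hF (hs (𝔾.mul a 𝔾.gen)) (Y := 𝔾.mul b 𝔾.gen)
    rw [Prog.runWithin_eq_sem A F _ _ h2 ht, h1]
  rw [e]
  have h : ∀ a : 𝔾.Scalar, (1 / 𝔾.N + simExpect (𝔾.mul a 𝔾.gen)
      (fun _ => forkInd (𝔾.mul a 𝔾.gen) F φ) F []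
      (.inl (([] : SimTable A), A.init (𝔾.mul a 𝔾.gen)))) / 2 ≤ 𝔼 b : 𝔾.Scalar,
      (Prog.cdhPMF A F (𝔾.mul a 𝔾.gen) (𝔾.mul b 𝔾.gen)
        (some (𝔾.mul (a * b) 𝔾.gen))).toReal := fun a =>
    Finset.le_expect Finset.univ_nonempty fun b _ => le_toReal_cdhPMF F φ
  refine le_trans (le_of_eq ?_) (Finset.expect_le_expect fun a _ => h a)
  rw [← Finset.expect_div, Finset.expect_add_distrib, Fintype.expect_const]

/-- The summand `1 / N` accounts for `d`, a unit in the experiment but any scalar in the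
Diffie–Hellman problem; the rest is the loss of `(B + 2) / N` in each of `B` transitions. -/
lemma toReal_advantage_le {B : ℕ} (hs : ∀ D, A.Bounded B B (A.init D)) :
    A.advantage.toReal ≤ (𝔼 a : 𝔾.Scalar, simExpect (𝔾.mul a 𝔾.gen)
        (winInd (𝔾.mul a 𝔾.gen) fun _ => True) B []
        (.inl (([] : SimTable A), A.init (𝔾.mul a 𝔾.gen)))) + (1 + B * (B + 2)) / 𝔾.N := by
  set W := (𝔼 a : 𝔾.Scalar, simExpect (𝔾.mul a 𝔾.gen)
        (winInd (𝔾.mul a 𝔾.gen) fun _ => True) B []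
        (.inl (([] : SimTable A), A.init (𝔾.mul a 𝔾.gen)))) with hW
  have hW0 : 0 ≤ W := Finset.expect_nonneg fun a _ => simExpect_nonneg (winInd_nonneg _ _)
  have key : ∀ n, ROM.prob (A.experiment n) (fun _ => none) ≤ W + (1 + B * (B + 2)) / 𝔾.N := by
    intro n
    obtain ⟨f, hf⟩ : ∃ f : 𝔾.Scalar → ℝ, ∀ d, f d = ROM.prob
      (A.play d n [] (A.init (𝔾.mul d 𝔾.gen))) (SimTable.values (A := A) []) := ⟨_, fun _ => rfl⟩
    have e : ROM.prob (A.experiment n) (fun _ => none) = 𝔼 b : (𝔾.Scalar)ˣ, f b := by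
      simp only [Adversary.experiment, AQ.setup, bind_assoc, pure_bind, ROM.prob_uniform, hf]
      rfl
    have hu : (𝔼 b : (𝔾.Scalar)ˣ, f b) ≤ (𝔼 b, f b) + 1 / 𝔾.N := by
      refine expect_units_le (fun b => ?_) fun b => ?_
      · rw [hf]
        exact ROM.prob_nonneg _ _
      · rw [hf]
        exact ROM.prob_le_one _ _
    have hle : (𝔼 b, f b) ≤ W + B * ((B + 2) / 𝔾.N) := by
      refine (Finset.expect_le_expect fun d _ => (hf d).trans_le
        (prob_play_le (m := B) (hs _) (by simp))).trans_eq ?_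
      rw [Finset.expect_add_distrib, Fintype.expect_const]
    rw [e, add_div, mul_div_assoc]
    linarith
  refine ENNReal.toReal_le_of_le_ofReal (by positivity) (iSup_le fun n => ?_)
  refine (ENNReal.le_ofReal_iff_toReal_le (PMF.apply_ne_top _ _) (by positivity)).2 (key n)

/-- Here `i` stands for `1 / N`. By `h2` both `i` and `V` are at most `2 * S`, and `i ^ 2 ≤ i`; then
`(a + b)² ≤ 2 * a² + 2 * b²` gives the constants. -/
lemma sq_le_of_forking_bounds {adv W V S i β : ℝ} (hadv : 0 ≤ adv) (hβ : 0 ≤ β) (hi0 : 0 ≤ i)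
    (hi1 : i ≤ 1) (hV : 0 ≤ V) (h1 : adv ≤ W + (1 + β * (β + 2)) * i) (h2 : (i + V) / 2 ≤ S)
    (h3 : W ^ 2 ≤ β * (V + β * i)) :
    adv ^ 2 ≤ (4 * (1 + β * (β + 2)) ^ 2 + 4 * β + 4 * β ^ 2) * S := by
  have hiS : i ≤ 2 * S := by linarith
  have hVS : V ≤ 2 * S := by linarith
  have hi2 : i ^ 2 ≤ 2 * S := by nlinarith
  have hW : W ^ 2 ≤ (2 * β + 2 * β ^ 2) * S := by
    have : β * (V + β * i) ≤ β * (2 * S + β * (2 * S)) := by gcongr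
    linarith
  have hc : ((1 + β * (β + 2)) * i) ^ 2 ≤ (1 + β * (β + 2)) ^ 2 * (2 * S) := by
    rw [mul_pow]
    gcongr
  have := pow_le_pow_left₀ hadv h1 2
  linarith [sq_nonneg (W - (1 + β * (β + 2)) * i)]

/-- The advantage of the adversary in terms of the success of the reduction. -/
lemma sq_advantage_le {B F t : ℕ} (hF : 2 * B < F) (ht : Prog.cdh.cost F ≤ t)
    (hs : ∀ D, A.Bounded B B (A.init D)) :
    A.advantage.toReal ^ 2 ≤ (4 * (1 + B * (B + 2)) ^ 2 + 4 * B + 4 * B ^ 2) *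
      (dhSuccess A Prog.cdh t).toReal := by
  -- Every input is fresh at the start, so the forking lemma covers all wins.
  have hfresh : SimTable.Fresh ([] : SimTable A) = fun _ => True := by
    funext k
    simp [SimTable.Fresh, SimTable.find]
  have hN : (1 : ℝ) ≤ 𝔾.N := by exact_mod_cast 𝔾.prime.one_le
  have h1 := toReal_advantage_le hs
  have h2 := le_toReal_dhSuccess hF ht hs fun _ => True
  set S := (dhSuccess A Prog.cdh t).toReal
  have hV0 : 0 ≤ 𝔼 a : 𝔾.Scalar, simExpect (𝔾.mul a 𝔾.gen)
        (fun _ => forkInd (𝔾.mul a 𝔾.gen) F fun _ => True) F []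
        (.inl (([] : SimTable A), A.init (𝔾.mul a 𝔾.gen))) :=
    Finset.expect_nonneg fun a _ => simExpect_nonneg fun _ _ => forkInd_nonneg _ _ _ _
  have h3 : (𝔼 a : 𝔾.Scalar, simExpect (𝔾.mul a 𝔾.gen)
        (winInd (𝔾.mul a 𝔾.gen) fun _ => True) B []
        (.inl (([] : SimTable A), A.init (𝔾.mul a 𝔾.gen)))) ^ 2 ≤
      B * ((𝔼 a : 𝔾.Scalar, simExpect (𝔾.mul a 𝔾.gen)
        (fun _ => forkInd (𝔾.mul a 𝔾.gen) F fun _ => True) F []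
        (.inl (([] : SimTable A), A.init (𝔾.mul a 𝔾.gen)))) + B / 𝔾.N) := by
    refine (sq_expect_le _).trans ?_
    rw [← Fintype.expect_const (ι := 𝔾.Scalar) ((B : ℝ) / 𝔾.N), ← Finset.expect_add_distrib,
      Finset.mul_expect]
    refine Finset.expect_le_expect fun a _ => ?_
    have := sq_simExpect_winInd_le (A := A) (𝔾.mul a 𝔾.gen) F (n := B) (L := [])
      (v := .inl (([] : SimTable A), A.init (𝔾.mul a 𝔾.gen))) (by omega)
    simp only [tableOf, hfresh] at this
    refine this.trans ?_
    gcongr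
    exact simExpect_mono (fun _ _ => forkInd_nonneg _ _ _ _) (by omega)
  have hadv : 0 ≤ A.advantage.toReal := ENNReal.toReal_nonneg
  have hi1 : 1 / (𝔾.N : ℝ) ≤ 1 := by rw [div_le_one (by linarith)]; exact hN
  rw [div_eq_mul_one_div] at h1
  rw [div_eq_mul_one_div (B : ℝ)] at h3
  exact sq_le_of_forking_bounds hadv (Nat.cast_nonneg B) (by positivity) hi1 hV0 h1 h2 h3

end success

/-! ## Asymptotics -/

/-- Use the decay of `q * g` against the power `2 * n`, then take square roots. -/
lemma Negligible.of_sq_le {f g : ℕ → ENNReal} (q : ℝ[X]) (hg : Negligible g)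
    (h : ∀ κ : ℕ, (f κ).toReal ^ 2 ≤ q.eval (κ : ℝ) * (g κ).toReal) : Negligible f := by
  intro n
  have hq := Asymptotics.SuperpolynomialDecay.polynomial_mul hg q (2 * n)
  have h2 : Filter.Tendsto (fun κ : ℕ => ((κ : ℝ) ^ n * (f κ).toReal) ^ 2) Filter.atTop
      (nhds 0) := by
    refine squeeze_zero (fun κ => sq_nonneg _) (fun κ => ?_) hq
    rw [mul_pow, ← pow_mul, mul_comm n 2]
    exact mul_le_mul_of_nonneg_left (h κ) (by positivity)
  have h3 := (Real.continuous_sqrt.tendsto 0).comp h2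
  rw [Real.sqrt_zero] at h3
  refine h3.congr fun κ => ?_
  exact Real.sqrt_sq (by positivity)

end
end SelfCert

theorem theorem1 :
    ∃ C : Prog (.prod .point .point) .point,
      ∀ (𝔾 : ℕ → PrimeGroup) (A : (κ : ℕ) → Adversary (𝔾 κ)) (qk qh : ℕ → ℕ),
        (∃ t : ℕ[X], ∀ (κ : ℕ) (D : (𝔾 κ).Point),
          (A κ).HaltsWithin (t.eval κ) (qk κ) (qh κ) ((A κ).init D)) →
        ¬ Negligible (fun κ => (A κ).advantage) →
        ∃ p : ℕ[X],
          (∀ (κ : ℕ) (X Y : (𝔾 κ).Point), C.HaltsWithin (A κ) (p.eval κ) (X, Y)) ∧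
          ¬ Negligible (fun κ => dhSuccess (A κ) C (p.eval κ)) := by
  refine ⟨Prog.cdh, fun 𝔾 A qk qh ⟨t, ht⟩ hadv => ?_⟩
  obtain ⟨c, hc⟩ := Prog.cdh.exists_cost_polynomial
  have hcost : ∀ κ : ℕ, Prog.cdh.cost (2 * t.eval κ + 1) = (c.comp (2 * t + 1)).eval κ :=
    fun κ => by simp [hc]
  have hs : ∀ (κ : ℕ) (D : (𝔾 κ).Point),
      (A κ).Bounded (t.eval κ) (t.eval κ) ((A κ).init D) := fun κ D => (ht κ D).bounded le_rfl
  refine ⟨c.comp (2 * t + 1), fun κ X Y => ?_, fun hneg => hadv ?_⟩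
  · obtain ⟨-, h⟩ := Prog.sem_cdh (F := 2 * t.eval κ + 1) (by omega) (hs κ X) (Y := Y)
    rw [Prog.HaltsWithin, Prog.runWithin_eq_sem _ _ _ _ h (hcost κ).le]
    exact h
  · set T : ℝ[X] := t.map (Nat.castRingHom ℝ) with hT
    refine hneg.of_sq_le (4 * (1 + T * (T + 2)) ^ 2 + 4 * T + 4 * T ^ 2) fun κ => ?_
    have := sq_advantage_le (F := 2 * t.eval κ + 1) (by omega) (hcost κ).le (hs κ)
    refine this.trans_eq ?_
    have e : T.eval (κ : ℝ) = ((t.eval κ : ℕ) : ℝ) := by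
      rw [hT, eval_natCast_map]
      rfl
    simp [e]
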